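/- **Setting.** Let $\mathcal H$ be a real Hilbert space, $\mathcal Y\subset\mathbb R^p$ non-empty and compact, and for $y\in\mathcal Y$ let $b_y$ be a symmetric continuous bilinear form on $\mathcal H$ and $f_y\in\mathcal H^*$ such that, with constants $C_{\mathrm{coer}},C_{\mathrm{cont}},C_{\mathrm{rhs}}>0$, $$|b_y(u,v)|\le C_{\mathrm{cont}}\|u\|\|v\|,\qquad b_y(u,u)\ge C_{\mathrm{coer}}\|u\|^2,\qquad \|f_y\|_{\mathcal H^*}\le C_{\mathrm{rhs}}\qquad(y\in\mathcal Y,\ u,v\in\mathcal H).$$ Let $u_y\in\mathcal H$ be the solution of $b_y(u_y,v)=f_y(v)$ for all $v\in\mathcal H$, and assume that $\{u_y: y\in\mathcal Y\}$ is compact. Let $(\varphi_i)_{i=1}^D\subset\mathcal H$ be linearly independent with Gram matrix $\mathbf G=(\langle\varphi_i,\varphi_j\rangle)_{i,j}$, and write $|\mathbf v|_{\mathbf G}=|\mathbf G^{1/2}\mathbf v|$. Assume that for some $\hat\epsilon>0$ the Galerkin solution $u_y^{\mathrm h}$ in $\mathrm{span}(\varphi_i)$ satisfies $\sup_{y}\|u_y-u_y^{\mathrm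 h}\|\le\hat\epsilon$. For every $\tilde\epsilon\ge\hat\epsilon$ let $d(\tilde\epsilon)\ge1$ and $\mathbf V_{\tilde\epsilon}\in\mathbb R^{D\times d(\tilde\epsilon)}$ be such that the vectors $\psi_i=\sum_j(\mathbf V_{\tilde\epsilon})_{j,i}\varphi_j$, $i\le d(\tilde\epsilon)$, are orthonormal in $\mathcal H$ and $\sup_y\mathrm{dist}(u_y,\mathrm{span}(\psi_i))\le\tilde\epsilon$. Put $\mathbf B^{\mathrm{rb}}_{y,\tilde\epsilon}=(b_y(\psi_j,\psi_i))_{i,j}$, $\mathbf f^{\mathrm{rb}}_{y,\tilde\epsilon}=(f_y(\psi_i))_i$, $\mathbf u^{\mathrm{rb}}_{y,\tilde\epsilon}=(\mathbf B^{\mathrm{rb}}_{y,\tilde\epsilon})^{-1}\mathbf f^{\mathrm{rb}}_{y,\tilde\epsilon}$, $\tilde{\mathbf u}^{\mathrm h}_{y,\tilde\epsilon}=\mathbf V_{\tilde\epsilon}\mathbf u^{\mathrm{rb}}_{y,\tilde\epsilon}$ and $\alpha=(2\max\{1,C_{\mathrm{cont}}\}^2)^{-1}$. **Networks.** A neural network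 (NN) is a sequence $\Phi=((\mathbf A_1,\mathbf b_1),\dots,(\mathbf A_L,\mathbf b_L))$, $L\ge1$, of matrices and vectors of matching sizes. With the ReLU function $\varrho(x)=\max\{x,0\}$ acting componentwise, its realization $\mathrm R(\Phi)$ maps $\mathbf x_0$ to $\mathbf x_L=\mathbf A_L\mathbf x_{L-1}+\mathbf b_L$, where $\mathbf x_\ell=\varrho(\mathbf A_\ell\mathbf x_{\ell-1}+\mathbf b_\ell)$ for $1\le\ell<L$. $L(\Phi)=L$ is the number of layers and $M(\Phi)$ is the number of non-zero entries of all $\mathbf A_\ell,\mathbf b_\ell$. The concatenation $\Phi^1\bullet\Phi^2$ merges the last (affine) layer of $\Phi^2$ with the first affine map of $\Phi^1$; it has $L(\Phi^1)+L(\Phi^2)-1$ layers. $\Phi^{\mathbf{Id}}_{n,L}$ is the $L$-layer NN realizing $\mathrm{id}_{\mathbb R^n}$, namely $((\mathbf{Id},0))$ for $L=1$ and $\big(\big(\binom{\mathbf{Id}}{-\mathbf{Id}},0\big),(\mathbf{Id},0),\dots,(\mathbf{Id},0),((\mathbf{Id}\,|\,{-\mathbf{Id}}),0)\big)$ for $L\ge2$.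 The sparse concatenation is $\Phi^1\odot\Phi^2=\Phi^1\bullet\Phi^{\mathbf{Id}}_{n,2}\bullet\Phi^2$. The parallelization $\mathrm P(\Phi^1,\Phi^2)$ of NNs with the same input first extends the shallower one to the depth $L$ of the other by replacing it with $\Phi^{\mathbf{Id}}_{n,L-L(\Phi^i)}\odot\Phi^i$, then stacks the first layers on top of each other and uses block diagonal matrices in all further layers, so that $\mathrm R(\mathrm P(\Phi^1,\Phi^2))=(\mathrm R(\Phi^1),\mathrm R(\Phi^2))$. $\mathbf{vec}$ is column-wise vectorization of square matrices and $\mathbf{matr}$ its inverse. **Assumptions.** For all $\tilde\epsilon\ge\hat\epsilon$, $\eta>0$ there are NNs $\Phi^{\mathbf B}_{\tilde\epsilon,\eta}$ (input dimension $p$, output dimension $d(\tilde\epsilon)^2$) and $\Phi^{\mathbf f}_{\tilde\epsilon,\eta}$ (input dimension $p$, output dimension $d(\tilde\epsilon)$) with $$\sup_{y\in\mathcal Y}\big\|\alpha\mathbf B^{\mathrm{rb}}_{y,\tilde\epsilon}-\mathbf{matr}(\mathrm R(\Phi^{\mathbf B}_{\tilde\epsilon,\eta})(y))\big\|_2\le\eta,\qquad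 \sup_{y\in\mathcal Y}\big|\mathbf f^{\mathrm{rb}}_{y,\tilde\epsilon}-\mathrm R(\Phi^{\mathbf f}_{\tilde\epsilon,\eta})(y)\big|\le\eta .$$ Write $B_L,B_M(\tilde\epsilon,\eta)$ and $F_L,F_M(\tilde\epsilon,\eta)$ for their numbers of layers and weights. **Theorem.** For $\epsilon>0$ put $\epsilon'=\epsilon/\max\{6,C_{\mathrm{rhs}}\}$, $\epsilon''=\frac{\epsilon}{3}C_{\mathrm{coer}}$, $\epsilon'''=\frac38\epsilon'\alpha C_{\mathrm{coer}}^2$ and $\kappa=2\max\{1,C_{\mathrm{rhs}},1/C_{\mathrm{coer}}\}$. There are constants $C_L^{\mathbf u},C_M^{\mathbf u}>0$ depending only on $C_{\mathrm{coer}},C_{\mathrm{cont}},C_{\mathrm{rhs}}$ and, for all $d\ge1$ and $\epsilon\in(0,\frac\alpha4\min\{1,C_{\mathrm{coer}}\})$, NNs $\Phi^{d,\epsilon}_{\mathrm{mult}}$ and $\Phi^{d,\epsilon}_{\mathrm{inv}}$ depending only on $d,\epsilon$ and these three constants, with $$\big|\mathbf A\mathbf w-\mathrm R(\Phi^{d,\epsilon}_{\mathrm{mult}})(\mathbf{vec}(\mathbf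 A),\mathbf w)\big|\le\tfrac\epsilon3\qquad(\mathbf A\in\mathbb R^{d\times d},\ \mathbf w\in\mathbb R^d,\ \|\mathbf A\|_2,|\mathbf w|\le\kappa),$$ $$\big\|(\mathbf{Id}-\mathbf A)^{-1}-\mathbf{matr}(\mathrm R(\Phi^{d,\epsilon}_{\mathrm{inv}})(\mathbf{vec}(\mathbf A)))\big\|_2\le\tfrac{\epsilon'}{2\alpha}\qquad(\mathbf A\in\mathbb R^{d\times d},\ \|\mathbf A\|_2\le1-\tfrac12\alpha C_{\mathrm{coer}}),$$ such that the following holds in every setting as above, for all $\tilde\epsilon\ge\hat\epsilon$ and $\epsilon\in(0,\frac\alpha4\min\{1,C_{\mathrm{coer}}\})$. Let $d=d(\tilde\epsilon)$, let $\Phi^{\mathbf B,\mathbf{Id}}=((-\mathbf{Id},\mathbf{vec}(\mathbf{Id})))\bullet\Phi^{\mathbf B}_{\tilde\epsilon,\epsilon'''}$ and $\Phi^{\mathbf B}_{\mathrm{inv}}=((\alpha\mathbf{Id},0))\bullet\big(\Phi^{d,\epsilon}_{\mathrm{inv}}\odot\Phi^{\mathbf B,\mathbf{Id}}\big)$, and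 define $$\Phi^{\mathbf u,\mathrm{rb}}=\Phi^{d,\epsilon}_{\mathrm{mult}}\odot\mathrm P\big(\Phi^{\mathbf B}_{\mathrm{inv}},\Phi^{\mathbf f}_{\tilde\epsilon,\epsilon''}\big),\qquad \Phi^{\mathbf u,\mathrm h}=((\mathbf V_{\tilde\epsilon},0))\odot\Phi^{\mathbf u,\mathrm{rb}}.$$ Write $\ell=\log_2(1/\epsilon)$. Then 1. $\sup_{y\in\mathcal Y}|\mathbf u^{\mathrm{rb}}_{y,\tilde\epsilon}-\mathrm R(\Phi^{\mathbf u,\mathrm{rb}})(y)|\le\epsilon$ and $\sup_{y\in\mathcal Y}|\tilde{\mathbf u}^{\mathrm h}_{y,\tilde\epsilon}-\mathrm R(\Phi^{\mathbf u,\mathrm h})(y)|_{\mathbf G}\le\epsilon$; 2. $L(\Phi^{\mathbf u,\mathrm{rb}})\le L(\Phi^{\mathbf u,\mathrm h})\le C^{\mathbf u}_L\log_2(\ell)\big(\ell+\log_2(\ell)+\log_2(d)\big)+\max\{B_L(\tilde\epsilon,\epsilon'''),F_L(\tilde\epsilon,\epsilon'')\}$; 3. $M(\Phi^{\mathbf u,\mathrm{rb}})\le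 C^{\mathbf u}_Md^2\Big(d\,\ell\log_2^2(\ell)\big(\ell+\log_2(\ell)+\log_2(d)\big)+B_L(\tilde\epsilon,\epsilon''')+F_L(\tilde\epsilon,\epsilon'')\Big)+2B_M(\tilde\epsilon,\epsilon''')+2F_M(\tilde\epsilon,\epsilon'')$; 4. $M(\Phi^{\mathbf u,\mathrm h})\le2Dd+2M(\Phi^{\mathbf u,\mathrm{rb}})$; 5. $\sup_{y\in\mathcal Y}|\mathrm R(\Phi^{\mathbf u,\mathrm{rb}})(y)|\le\kappa^2+\frac\epsilon3$ and $\sup_{y\in\mathcal Y}|\mathrm R(\Phi^{\mathbf u,\mathrm h})(y)|_{\mathbf G}\le\kappa^2+\frac\epsilon3$. -/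

import Mathlib

universe u

namespace RBNN

open scoped Matrix

/-! ### Vectors and matrices -/

/-- The Euclidean norm of a vector in `ℝⁿ`. -/
noncomputable def euclid {n : ℕ} (v : Fin n → ℝ) : ℝ :=
  ‖(WithLp.toLp 2 v : EuclideanSpace ℝ (Fin n))‖

section SpectralNorm

open scoped Matrix.Norms.L2Operator

/-- The spectral norm of a real matrix. -/
noncomputable def specNorm {m n : ℕ} (A : Matrix (Fin m) (Fin n) ℝ) : ℝ := ‖A‖

end SpectralNorm

/-- Column-wise vectorisation of a square matrix. -/
def vec {d : ℕ} (A : Matrix (Fin d) (Fin d) ℝ) : Fin (d * d) → ℝ :=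
  fun k => A (finProdFinEquiv.symm k).2 (finProdFinEquiv.symm k).1

/-- The matrix with a given column-wise vectorisation. -/
def matr {d : ℕ} (v : Fin (d * d) → ℝ) : Matrix (Fin d) (Fin d) ℝ :=
  Matrix.of fun i j => v (finProdFinEquiv (j, i))

/-- `A` on top of `A'`. -/
noncomputable def stackRows {k k' m : ℕ} (A : Matrix (Fin k) (Fin m) ℝ) (A' : Matrix (Fin k') (Fin m) ℝ) :
    Matrix (Fin (k + k')) (Fin m) ℝ :=
  Matrix.reindex finSumFinEquiv (Equiv.refl _) (Matrix.fromRows A A')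

/-- `A` to the left of `A'`. -/
noncomputable def stackCols {k m m' : ℕ} (A : Matrix (Fin k) (Fin m) ℝ) (A' : Matrix (Fin k) (Fin m') ℝ) :
    Matrix (Fin k) (Fin (m + m')) ℝ :=
  Matrix.reindex (Equiv.refl _) finSumFinEquiv (Matrix.fromCols A A')

/-- The block diagonal matrix with blocks `A`, `A'`. -/
noncomputable def blockDiag {k k' m m' : ℕ} (A : Matrix (Fin k) (Fin m) ℝ) (A' : Matrix (Fin k') (Fin m') ℝ) :
    Matrix (Fin (k + k')) (Fin (m + m')) ℝ :=
  Matrix.reindex finSumFinEquiv finSumFinEquiv (Matrix.fromBlocks A 0 0 A')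

open Classical in
/-- The number of non-zero entries of a matrix. -/
noncomputable def nnzMat {k m : ℕ} (A : Matrix (Fin k) (Fin m) ℝ) : ℕ :=
  (Finset.univ.filter fun ij : Fin k × Fin m => A ij.1 ij.2 ≠ 0).card

open Classical in
/-- The number of non-zero entries of a vector. -/
noncomputable def nnzVec {k : ℕ} (v : Fin k → ℝ) : ℕ :=
  (Finset.univ.filter fun i : Fin k => v i ≠ 0).card

/-! ### Neural networks -/

/-- `NN m n` is the type of neural networks `((A₁, b₁), …, (A_L, b_L))`, `L ≥ 1`, with input
dimension `m` and output dimension `n`: either the single pair `(A₁, b₁)`, or a first pair followed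
by a neural network with one layer less. -/
inductive NN : ℕ → ℕ → Type
  | last {m n : ℕ} (A : Matrix (Fin n) (Fin m) ℝ) (b : Fin n → ℝ) : NN m n
  | layer {m k n : ℕ} (A : Matrix (Fin k) (Fin m) ℝ) (b : Fin k → ℝ) (Φ : NN k n) : NN m n

namespace NN

/-- The ReLU realization. -/
noncomputable def realize : {m n : ℕ} → NN m n → (Fin m → ℝ) → (Fin n → ℝ)
  | _, _, last A b, x => A *ᵥ x + b
  | _, _, layer A b Φ, x => Φ.realize fun i => max ((A *ᵥ x + b) i) 0

/-- The number of layers `L(Φ)`. -/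
def depth : {m n : ℕ} → NN m n → ℕ
  | _, _, last _ _ => 1
  | _, _, layer _ _ Φ => Φ.depth + 1

/-- The number of weights `M(Φ)`. -/
noncomputable def weights : {m n : ℕ} → NN m n → ℕ
  | _, _, last A b => nnzMat A + nnzVec b
  | _, _, layer A b Φ => nnzMat A + nnzVec b + Φ.weights

/-- Precomposition of a network with an affine map, merged into its first layer. -/
noncomputable def preAffine : {m k n : ℕ} → NN k n → Matrix (Fin k) (Fin m) ℝ → (Fin k → ℝ) → NN m n
  | _, _, _, last A₁ b₁, A, b => last (A₁ * A) (A₁ *ᵥ b + b₁)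
  | _, _, _, layer A₁ b₁ Φ, A, b => layer (A₁ * A) (A₁ *ᵥ b + b₁) Φ

/-- The concatenation `Φ¹ • Φ²`, with `L(Φ¹) + L(Φ²) - 1` layers. -/
noncomputable def concat : {m k n : ℕ} → NN k n → NN m k → NN m n
  | _, _, _, Φ₁, last A b => preAffine Φ₁ A b
  | _, _, _, Φ₁, layer A b Φ₂ => layer A b (concat Φ₁ Φ₂)

/-- `j` hidden layers with identity weights, followed by the output layer `(Id | -Id)`. -/
noncomputable def idTail (n : ℕ) : ℕ → NN (n + n) n
  | 0 => last (stackCols 1 (-1)) 0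
  | j + 1 => layer 1 0 (idTail n j)

/-- The ReLU network `Φ^Id_{n,L}` with `L` layers that realizes the identity of `ℝⁿ`, with at most
`2nL` non-zero weights, all of them `±1`. (The value at `L = 0` is never used.) -/
noncomputable def idNet (n : ℕ) : ℕ → NN n n
  | 0 => last 1 0
  | 1 => last 1 0
  | j + 2 => layer (stackRows 1 (-1)) 0 (idTail n j)

/-- The sparse concatenation `Φ¹ ⊙ Φ²`, with `L(Φ¹) + L(Φ²)` layers: the concatenation with a
two-layer identity network in between. -/
noncomputable def sparseConcat {m k n : ℕ} (Φ₁ : NN k n) (Φ₂ : NN m k) : NN m n :=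
  concat Φ₁ (concat (idNet k 2) Φ₂)

/-- Two networks of equal depth side by side, acting on separate inputs. (The value on networks of
different depths is never used.) -/
noncomputable def sideBySide : {m m' n n' : ℕ} → NN m n → NN m' n' → NN (m + m') (n + n')
  | _, _, _, _, last A b, last A' b' => last (blockDiag A A') (Fin.append b b')
  | _, _, _, _, layer A b Φ, layer A' b' Φ' =>
      layer (blockDiag A A') (Fin.append b b') (sideBySide Φ Φ')
  | _, _, _, _, last _ _, layer _ _ _ => last 0 0
  | _, _, _, _, layer _ _ _, last _ _ => last 0 0

/-- Two networks of equal depth in parallel, acting on the same input. (The value on networks of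
different depths is never used.) -/
noncomputable def parEq : {m n n' : ℕ} → NN m n → NN m n' → NN m (n + n')
  | _, _, _, last A b, last A' b' => last (stackRows A A') (Fin.append b b')
  | _, _, _, layer A b Φ, layer A' b' Φ' =>
      layer (stackRows A A') (Fin.append b b') (sideBySide Φ Φ')
  | _, _, _, last _ _, layer _ _ _ => last 0 0
  | _, _, _, layer _ _ _, last _ _ => last 0 0

/-- The extension `E_L(Φ)` of `Φ` to `L ≥ L(Φ)` layers. -/
noncomputable def extend {m n : ℕ} (L : ℕ) (Φ : NN m n) : NN m n :=
  if Φ.depth = L then Φ else sparseConcat (idNet n (L - Φ.depth)) Φ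

/-- The parallelization `P(Φ, Φ')`. -/
noncomputable def par {m n n' : ℕ} (Φ : NN m n) (Φ' : NN m n') : NN m (n + n') :=
  parEq (extend (max Φ.depth Φ'.depth) Φ) (extend (max Φ.depth Φ'.depth) Φ')

end NN

/-! ### Galerkin discretisations -/

section Galerkin

variable {H : Type u} [NormedAddCommGroup H] [InnerProductSpace ℝ H]

/-- `u` solves the variational problem `b(u, v) = f(v)` for all `v`. -/
def IsSol (b : H →L[ℝ] H →L[ℝ] ℝ) (f : H →L[ℝ] ℝ) (u : H) : Prop := ∀ v, b u v = f v

/-- The stiffness matrix `(b(φⱼ, φᵢ))ᵢⱼ`. -/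
noncomputable def stiffness {n : ℕ} (b : H →L[ℝ] H →L[ℝ] ℝ) (φ : Fin n → H) : Matrix (Fin n) (Fin n) ℝ :=
  Matrix.of fun i j => b (φ j) (φ i)

/-- The discretised right-hand side `(f(φᵢ))ᵢ`. -/
noncomputable def load {n : ℕ} (f : H →L[ℝ] ℝ) (φ : Fin n → H) : Fin n → ℝ := fun i => f (φ i)

/-- The coefficient vector of the Galerkin solution with respect to `φ`. -/
noncomputable def galerkin {n : ℕ} (b : H →L[ℝ] H →L[ℝ] ℝ) (f : H →L[ℝ] ℝ) (φ : Fin n → H) :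
    Fin n → ℝ :=
  (stiffness b φ)⁻¹ *ᵥ load f φ

section SquareRoot

open scoped MatrixOrder Matrix.Norms.L2Operator

/-- The norm `|v|_G = |G^{1/2} v|` for the Gram matrix `G = (⟨φᵢ, φⱼ⟩)ᵢⱼ`. -/
noncomputable def gNorm {n : ℕ} (φ : Fin n → H) (v : Fin n → ℝ) : ℝ :=
  euclid (CFC.sqrt (Matrix.gram ℝ φ) *ᵥ v)

end SquareRoot

/-- The vectors `ψᵢ = ∑ⱼ Vⱼᵢ φⱼ`. -/
noncomputable def transformBasis {D d : ℕ} (φ : Fin D → H) (V : Matrix (Fin D) (Fin d) ℝ) :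
    Fin d → H :=
  fun i => ∑ j, V j i • φ j

end Galerkin

/-- A parametric variational problem `b_y(u_y, v) = f_y(v)` on a real Hilbert space `H` with
parameter set `Y ⊆ ℝᵖ`, with symmetric, uniformly continuous and uniformly coercive forms,
uniformly bounded right-hand sides and compact solution manifold, together with a high-fidelity
basis `φ` of accuracy `epsHat` and, for every `t ≥ epsHat`, an `H`-orthonormal reduced basis of
accuracy `t` that consists of `d t` linear combinations of the `φⱼ` with coefficients `V t`. -/
structure ReducedBasisProblem (p D : ℕ) (H : Type u) [NormedAddCommGroup H]
    [InnerProductSpace ℝ H] (Ccoer Ccont Crhs : ℝ) where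
  Y : Set (Fin p → ℝ)
  b : (Fin p → ℝ) → H →L[ℝ] H →L[ℝ] ℝ
  f : (Fin p → ℝ) → H →L[ℝ] ℝ
  isCompact_Y : IsCompact Y
  nonempty_Y : Y.Nonempty
  symm : ∀ y ∈ Y, ∀ u v, b y u v = b y v u
  cont : ∀ y ∈ Y, ∀ u v, |b y u v| ≤ Ccont * ‖u‖ * ‖v‖
  coer : ∀ y ∈ Y, ∀ u, u ≠ 0 → Ccoer ≤ b y u u / ‖u‖ ^ 2
  rhs : ∀ y ∈ Y, ‖f y‖ ≤ Crhs
  isCompact_sol : IsCompact {u | ∃ y ∈ Y, IsSol (b y) (f y) u}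
  φ : Fin D → H
  linearIndependent_φ : LinearIndependent ℝ φ
  epsHat : ℝ
  epsHat_pos : 0 < epsHat
  high_fidelity : ∀ y ∈ Y, ∀ u, IsSol (b y) (f y) u →
    ‖u - ∑ i, galerkin (b y) (f y) φ i • φ i‖ ≤ epsHat
  d : ℝ → ℕ
  d_pos : ∀ t, epsHat ≤ t → 1 ≤ d t
  V : (t : ℝ) → Matrix (Fin D) (Fin (d t)) ℝ
  orthonormal : ∀ t, epsHat ≤ t → Orthonormal ℝ (transformBasis φ (V t))
  reduced_basis : ∀ t, epsHat ≤ t → ∀ y ∈ Y, ∀ u, IsSol (b y) (f y) u →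
    Metric.infDist u (Submodule.span ℝ (Set.range (transformBasis φ (V t))) : Set H) ≤ t

namespace ReducedBasisProblem

variable {p D : ℕ} {H : Type u} [NormedAddCommGroup H] [InnerProductSpace ℝ H]
  {Ccoer Ccont Crhs : ℝ}

/-- The reduced basis `(ψᵢ)`. -/
noncomputable def ψ (S : ReducedBasisProblem p D H Ccoer Ccont Crhs) (t : ℝ) : Fin (S.d t) → H :=
  transformBasis S.φ (S.V t)

/-- The reduced-basis stiffness matrix `B^rb`. -/
noncomputable def Brb (S : ReducedBasisProblem p D H Ccoer Ccont Crhs) (t : ℝ) (y : Fin p → ℝ) :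
    Matrix (Fin (S.d t)) (Fin (S.d t)) ℝ :=
  stiffness (S.b y) (S.ψ t)

/-- The reduced-basis right-hand side `f^rb`. -/
noncomputable def frb (S : ReducedBasisProblem p D H Ccoer Ccont Crhs) (t : ℝ) (y : Fin p → ℝ) :
    Fin (S.d t) → ℝ :=
  load (S.f y) (S.ψ t)

/-- The reduced-basis coefficients `u^rb = (B^rb)⁻¹ f^rb`. -/
noncomputable def urb (S : ReducedBasisProblem p D H Ccoer Ccont Crhs) (t : ℝ) (y : Fin p → ℝ) :
    Fin (S.d t) → ℝ :=
  (S.Brb t y)⁻¹ *ᵥ S.frb t y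

/-- The high-fidelity coefficients `ũ^h = V u^rb` of the reduced-basis solution. -/
noncomputable def uh (S : ReducedBasisProblem p D H Ccoer Ccont Crhs) (t : ℝ) (y : Fin p → ℝ) :
    Fin D → ℝ :=
  S.V t *ᵥ S.urb t y

end ReducedBasisProblem

/-! ### The constants and the networks -/

/-- The scaling factor `α = (2 max{1, C_cont}²)⁻¹`. -/
noncomputable def alpha (Ccont : ℝ) : ℝ := (2 * max 1 Ccont ^ 2)⁻¹

/-- `κ = 2 max{1, C_rhs, 1 / C_coer}`. -/
noncomputable def kappa (Ccoer Crhs : ℝ) : ℝ := 2 * max 1 (max Crhs (1 / Ccoer))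

/-- `ε' = ε / max{6, C_rhs}`. -/
noncomputable def eps1 (Crhs ε : ℝ) : ℝ := ε / max 6 Crhs

/-- `ε'' = ε / 3 · C_coer`. -/
noncomputable def eps2 (Ccoer ε : ℝ) : ℝ := ε / 3 * Ccoer

/-- `ε''' = 3 / 8 · ε' α C_coer²`. -/
noncomputable def eps3 (Ccoer Ccont Crhs ε : ℝ) : ℝ :=
  3 / 8 * eps1 Crhs ε * alpha Ccont * Ccoer ^ 2

/-- `Φ` approximates `(A, w) ↦ A w` up to `η` for `d × d` matrices and vectors of norm at
most `Z`. -/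
def ApproxMult {d : ℕ} (Φ : NN (d * d + d) d) (Z η : ℝ) : Prop :=
  ∀ (A : Matrix (Fin d) (Fin d) ℝ) (w : Fin d → ℝ), specNorm A ≤ Z → euclid w ≤ Z →
    euclid (A *ᵥ w - Φ.realize (Fin.append (vec A) w)) ≤ η

/-- `Φ` approximates `A ↦ (Id - A)⁻¹` up to `η` for `d × d` matrices of norm at most `r`. -/
def ApproxInv {d : ℕ} (Φ : NN (d * d) (d * d)) (r η : ℝ) : Prop :=
  ∀ A : Matrix (Fin d) (Fin d) ℝ, specNorm A ≤ r →
    specNorm ((1 - A)⁻¹ - matr (Φ.realize (vec A))) ≤ η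

/-- `Φ^{B,Id}`, which realizes `vec(Id) - R(Φ^B)`. -/
noncomputable def idMinusNet {p d : ℕ} (ΦB : NN p (d * d)) : NN p (d * d) :=
  NN.concat (NN.last (-1) (vec 1)) ΦB

/-- `Φ^B_inv = ((a Id, 0)) • Φ_inv ⊙ Φ^{B,Id}`. -/
noncomputable def invStiffnessNet {p d : ℕ} (a : ℝ) (Φinv : NN (d * d) (d * d)) (ΦB : NN p (d * d)) :
    NN p (d * d) :=
  NN.concat (NN.last (a • 1) 0) (NN.sparseConcat Φinv (idMinusNet ΦB))

/-- `Φ^{u,rb} = Φ_mult ⊙ P(Φ^B_inv, Φ^f)`. -/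
noncomputable def rbNet {p d : ℕ} (a : ℝ) (Φmult : NN (d * d + d) d) (Φinv : NN (d * d) (d * d))
    (ΦB : NN p (d * d)) (Φf : NN p d) : NN p d :=
  NN.sparseConcat Φmult (NN.par (invStiffnessNet a Φinv ΦB) Φf)

/-- `Φ^{u,h} = ((V, 0)) ⊙ Φ^{u,rb}`. -/
noncomputable def hNet {p d D : ℕ} (V : Matrix (Fin D) (Fin d) ℝ) (Φrb : NN p d) : NN p D :=
  NN.sparseConcat (NN.last V 0) Φrb

end RBNN

open RBNN

/-! The factor `α` makes `α * Ccont ≤ 1/2`. In an orthonormal reduced basis, symmetry, continuity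
and coercivity therefore put the spectrum of `α B^rb` into `[α Ccoer, 1/2]`, and `Id - α B^rb` has
norm at most `1 - α Ccoer < 1`, whatever the dimension (`specNorm_one_sub_le`). So `(α B^rb)⁻¹` is a
geometrically convergent Neumann series, and it remains one, with ratio `1 - α Ccoer / 2`, when `α
B^rb` is replaced by its network approximation. It remains to build ReLU networks that multiply.

Scalar products come from the parabola `h z = z (1 - z)`: if `z± = 1/2 + (x ± y)/(2K)` then `K² (h
z₋ - h z₊) = x y`. The tent map `g` satisfies `4 h z = g z + h (g z)`, so `T` tent layers of
constant width give `h` up to `4^(-T) / 4` (`abs_tentStep_iterate_sub_le`). Running one pair of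
copies per scalar product yields all entries of a matrix product in parallel (`exists_productNet`).

For the inverse, `(Id - A)⁻¹ = ∏ (Id + A^(2^k))` is computed by the iteration `(P, S) ↦ (P², (1 + P)
S)` from `(A, 1)`. With inexact products of error `η`, errors after `k` steps are of order `4^k η`,
while `S` stays bounded by `3 / (1 - r)` (`neumann_bounds`). Hence about `log₂ ℓ` steps suffice,
each of depth about `ℓ + log₂ ℓ + log₂ d` (`exists_neumann_parameters`), which explains the shape of
the depth and weight bounds.

The total error splits into the errors of the right-hand side, of the inverse and of the final
product (`euclid_urb_sub_realize_le`). Passing to the high-fidelity basis costs nothing: `V` is an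
isometry from the Euclidean norm to the `G`-norm (`gNorm_mulVec`). For the weights, sparse
concatenation only doubles the two layers that meet, so it is enough to track total and last-layer
weights side by side. -/

namespace RBNN

open scoped Matrix

/-! ### Counting non-zero entries -/

lemma nnzMat_eq_sum {k m : ℕ} (A : Matrix (Fin k) (Fin m) ℝ) :
    nnzMat A = ∑ i, ∑ j, (if A i j = 0 then 0 else 1) := by
  classical
  rw [nnzMat, Finset.card_filter, Fintype.sum_prod_type]
  refine Finset.sum_congr rfl fun i _ => Finset.sum_congr rfl fun j _ => ?_
  by_cases h : A i j = 0 <;> simp [h]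

lemma nnzVec_eq_sum {k : ℕ} (v : Fin k → ℝ) :
    nnzVec v = ∑ i, (if v i = 0 then 0 else 1) := by
  classical
  rw [nnzVec, Finset.card_filter]
  refine Finset.sum_congr rfl fun i _ => ?_
  by_cases h : v i = 0 <;> simp [h]

section Entries

variable {k k' m m' : ℕ}

@[simp] lemma stackRows_castAdd (A : Matrix (Fin k) (Fin m) ℝ) (A' : Matrix (Fin k') (Fin m) ℝ)
    (i : Fin k) (j : Fin m) : stackRows A A' (Fin.castAdd k' i) j = A i j := by
  simp [stackRows]

@[simp] lemma stackRows_natAdd (A : Matrix (Fin k) (Fin m) ℝ) (A' : Matrix (Fin k') (Fin m) ℝ)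
    (i : Fin k') (j : Fin m) : stackRows A A' (Fin.natAdd k i) j = A' i j := by
  simp [stackRows]

@[simp] lemma stackCols_castAdd (A : Matrix (Fin k) (Fin m) ℝ) (A' : Matrix (Fin k) (Fin m') ℝ)
    (i : Fin k) (j : Fin m) : stackCols A A' i (Fin.castAdd m' j) = A i j := by
  simp [stackCols]

@[simp] lemma stackCols_natAdd (A : Matrix (Fin k) (Fin m) ℝ) (A' : Matrix (Fin k) (Fin m') ℝ)
    (i : Fin k) (j : Fin m') : stackCols A A' i (Fin.natAdd m j) = A' i j := by
  simp [stackCols]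

@[simp] lemma blockDiag_castAdd_castAdd (A : Matrix (Fin k) (Fin m) ℝ)
    (A' : Matrix (Fin k') (Fin m') ℝ) (i : Fin k) (j : Fin m) :
    blockDiag A A' (Fin.castAdd k' i) (Fin.castAdd m' j) = A i j := by
  simp [blockDiag]

@[simp] lemma blockDiag_castAdd_natAdd (A : Matrix (Fin k) (Fin m) ℝ)
    (A' : Matrix (Fin k') (Fin m') ℝ) (i : Fin k) (j : Fin m') :
    blockDiag A A' (Fin.castAdd k' i) (Fin.natAdd m j) = 0 := by
  simp [blockDiag]

@[simp] lemma blockDiag_natAdd_castAdd (A : Matrix (Fin k) (Fin m) ℝ)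
    (A' : Matrix (Fin k') (Fin m') ℝ) (i : Fin k') (j : Fin m) :
    blockDiag A A' (Fin.natAdd k i) (Fin.castAdd m' j) = 0 := by
  simp [blockDiag]

@[simp] lemma blockDiag_natAdd_natAdd (A : Matrix (Fin k) (Fin m) ℝ)
    (A' : Matrix (Fin k') (Fin m') ℝ) (i : Fin k') (j : Fin m') :
    blockDiag A A' (Fin.natAdd k i) (Fin.natAdd m j) = A' i j := by
  simp [blockDiag]

lemma nnzMat_stackRows (A : Matrix (Fin k) (Fin m) ℝ) (A' : Matrix (Fin k') (Fin m) ℝ) :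
    nnzMat (stackRows A A') = nnzMat A + nnzMat A' := by
  simp only [nnzMat_eq_sum, Fin.sum_univ_add, stackRows_castAdd, stackRows_natAdd]

lemma nnzMat_stackCols (A : Matrix (Fin k) (Fin m) ℝ) (A' : Matrix (Fin k) (Fin m') ℝ) :
    nnzMat (stackCols A A') = nnzMat A + nnzMat A' := by
  simp only [nnzMat_eq_sum, Fin.sum_univ_add, stackCols_castAdd, stackCols_natAdd,
    Finset.sum_add_distrib]

lemma nnzMat_blockDiag (A : Matrix (Fin k) (Fin m) ℝ) (A' : Matrix (Fin k') (Fin m') ℝ) :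
    nnzMat (blockDiag A A') = nnzMat A + nnzMat A' := by
  simp [nnzMat_eq_sum, Fin.sum_univ_add]

lemma nnzVec_append (v : Fin k → ℝ) (w : Fin k' → ℝ) :
    nnzVec (Fin.append v w) = nnzVec v + nnzVec w := by
  simp only [nnzVec_eq_sum, Fin.sum_univ_add, Fin.append_left, Fin.append_right]

@[simp] lemma nnzMat_neg (A : Matrix (Fin k) (Fin m) ℝ) : nnzMat (-A) = nnzMat A := by
  simp [nnzMat]

@[simp] lemma nnzVec_neg (v : Fin k → ℝ) : nnzVec (-v) = nnzVec v := by
  simp [nnzVec]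

@[simp] lemma nnzVec_zero : nnzVec (0 : Fin k → ℝ) = 0 := by
  simp [nnzVec]

lemma nnzMat_le (A : Matrix (Fin k) (Fin m) ℝ) : nnzMat A ≤ k * m := by
  refine (Finset.card_filter_le _ _).trans ?_
  simp

lemma nnzVec_le (v : Fin k → ℝ) : nnzVec v ≤ k := by
  refine (Finset.card_filter_le _ _).trans ?_
  simp

@[simp] lemma nnzMat_one : nnzMat (1 : Matrix (Fin k) (Fin k) ℝ) = k := by
  simp [nnzMat_eq_sum, Matrix.one_apply]

lemma nnzMat_smul_le (a : ℝ) (A : Matrix (Fin k) (Fin m) ℝ) : nnzMat (a • A) ≤ nnzMat A := by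
  classical
  refine Finset.card_le_card fun ij h => ?_
  simp only [Finset.mem_filter, Finset.mem_univ, true_and, Matrix.smul_apply, smul_eq_mul] at h ⊢
  exact right_ne_zero_of_mul h

lemma nnzVec_smul_le (a : ℝ) (v : Fin k → ℝ) : nnzVec (a • v) ≤ nnzVec v := by
  classical
  refine Finset.card_le_card fun ij h => ?_
  simp only [Finset.mem_filter, Finset.mem_univ, true_and, Pi.smul_apply, smul_eq_mul] at h ⊢
  exact right_ne_zero_of_mul h

lemma nnzVec_add_le (v w : Fin k → ℝ) : nnzVec (v + w) ≤ nnzVec v + nnzVec w := by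
  simp only [nnzVec_eq_sum, ← Finset.sum_add_distrib]
  refine Finset.sum_le_sum fun i _ => ?_
  by_cases hv : v i = 0 <;> by_cases hw : w i = 0 <;> simp [hv, hw]
  split <;> simp

/-- A matrix whose rows have at most `c` non-zero entries. -/
lemma nnzMat_le_of_rows {c : ℕ} (A : Matrix (Fin k) (Fin m) ℝ)
    (h : ∀ i, nnzVec (A i) ≤ c) : nnzMat A ≤ k * c := by
  rw [nnzMat_eq_sum]
  calc _ ≤ ∑ _i : Fin k, c := Finset.sum_le_sum fun i _ => by rw [← nnzVec_eq_sum]; exact h i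
    _ = k * c := by simp

lemma nnzMat_transpose (A : Matrix (Fin k) (Fin m) ℝ) : nnzMat Aᵀ = nnzMat A := by
  rw [nnzMat_eq_sum, nnzMat_eq_sum, Finset.sum_comm]; rfl

lemma stackRows_one_neg_one_mul (A : Matrix (Fin k) (Fin m) ℝ) :
    stackRows (1 : Matrix (Fin k) (Fin k) ℝ) (-1 : Matrix (Fin k) (Fin k) ℝ) * A
      = stackRows A (-A) := by
  ext i j
  refine Fin.addCases (fun i => ?_) (fun i => ?_) i <;>
    simp [Matrix.mul_apply, Matrix.one_apply, -Fin.natAdd_eq_addNat]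

lemma mul_stackCols_one_neg_one (A : Matrix (Fin k) (Fin m) ℝ) :
    A * stackCols (1 : Matrix (Fin m) (Fin m) ℝ) (-1 : Matrix (Fin m) (Fin m) ℝ)
      = stackCols A (-A) := by
  ext i j
  refine Fin.addCases (fun i => ?_) (fun i => ?_) j <;>
    simp [Matrix.mul_apply, Matrix.one_apply, -Fin.natAdd_eq_addNat]

lemma stackRows_mulVec (A : Matrix (Fin k) (Fin m) ℝ) (A' : Matrix (Fin k') (Fin m) ℝ)
    (x : Fin m → ℝ) : stackRows A A' *ᵥ x = Fin.append (A *ᵥ x) (A' *ᵥ x) := by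
  ext i
  refine Fin.addCases (fun i => ?_) (fun i => ?_) i <;> simp [Matrix.mulVec, dotProduct]

lemma stackCols_mulVec (A : Matrix (Fin k) (Fin m) ℝ) (A' : Matrix (Fin k) (Fin m') ℝ)
    (x : Fin m → ℝ) (x' : Fin m' → ℝ) :
    stackCols A A' *ᵥ Fin.append x x' = A *ᵥ x + A' *ᵥ x' := by
  ext i
  simp [Matrix.mulVec, dotProduct, Fin.sum_univ_add]

lemma blockDiag_mulVec (A : Matrix (Fin k) (Fin m) ℝ) (A' : Matrix (Fin k') (Fin m') ℝ)
    (x : Fin m → ℝ) (x' : Fin m' → ℝ) :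
    blockDiag A A' *ᵥ Fin.append x x' = Fin.append (A *ᵥ x) (A' *ᵥ x') := by
  ext i
  refine Fin.addCases (fun i => ?_) (fun i => ?_) i <;>
    simp [Matrix.mulVec, dotProduct, Fin.sum_univ_add]

lemma append_add_append (x y : Fin m → ℝ) (x' y' : Fin m' → ℝ) :
    Fin.append x x' + Fin.append y y' = Fin.append (x + y) (x' + y') := by
  ext i
  refine Fin.addCases (fun i => ?_) (fun i => ?_) i <;> simp

lemma relu_append (x : Fin m → ℝ) (x' : Fin m' → ℝ) :
    (fun i => max (Fin.append x x' i) 0)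
      = Fin.append (fun i => max (x i) 0) (fun i => max (x' i) 0) := by
  ext i
  refine Fin.addCases (fun i => ?_) (fun i => ?_) i <;> simp

end Entries

namespace NN

/-! ### Weights of the first and of the last layer -/

/-- The number of weights of the first layer. -/
noncomputable def firstWeights : {m n : ℕ} → NN m n → ℕ
  | _, _, last A b => nnzMat A + nnzVec b
  | _, _, layer A b _ => nnzMat A + nnzVec b

/-- The number of weights of the last layer. -/
noncomputable def lastWeights : {m n : ℕ} → NN m n → ℕ
  | _, _, last A b => nnzMat A + nnzVec b
  | _, _, layer _ _ Φ => Φ.lastWeights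

lemma firstWeights_le {m n : ℕ} (Φ : NN m n) : Φ.firstWeights ≤ Φ.weights := by
  cases Φ <;> simp [firstWeights, weights]

lemma lastWeights_le {m n : ℕ} (Φ : NN m n) : Φ.lastWeights ≤ Φ.weights := by
  induction Φ with
  | last A b => simp [lastWeights, weights]
  | layer A b Φ ih => simp only [lastWeights, weights]; omega

lemma depth_pos {m n : ℕ} (Φ : NN m n) : 1 ≤ Φ.depth := by
  cases Φ <;> simp [depth]

/-! ### Concatenation -/

lemma realize_preAffine {m k n : ℕ} (Φ : NN k n) (A : Matrix (Fin k) (Fin m) ℝ) (b : Fin k → ℝ)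
    (x : Fin m → ℝ) : (preAffine Φ A b).realize x = Φ.realize (A *ᵥ x + b) := by
  cases Φ <;> simp [preAffine, realize, Matrix.mulVec_add, Matrix.mulVec_mulVec, add_assoc]

lemma depth_preAffine {m k n : ℕ} (Φ : NN k n) (A : Matrix (Fin k) (Fin m) ℝ) (b : Fin k → ℝ) :
    (preAffine Φ A b).depth = Φ.depth := by
  cases Φ <;> rfl

lemma realize_concat {m k n : ℕ} (Φ₁ : NN k n) (Φ₂ : NN m k) (x : Fin m → ℝ) :
    (concat Φ₁ Φ₂).realize x = Φ₁.realize (Φ₂.realize x) := by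
  induction Φ₂ with
  | last A b => simp [concat, realize, realize_preAffine]
  | layer A b Φ ih => simp [concat, realize, ih]

lemma depth_concat_add_one {m k n : ℕ} (Φ₁ : NN k n) (Φ₂ : NN m k) :
    (concat Φ₁ Φ₂).depth + 1 = Φ₁.depth + Φ₂.depth := by
  induction Φ₂ with
  | last A b => simp [concat, depth, depth_preAffine]
  | layer A b Φ ih => simp only [concat, depth]; have := ih Φ₁; omega

/-- ReLU fixes nonnegative vectors, so the positive and negative parts of an input pass unchanged
through the hidden layers and are subtracted at the end. -/
lemma realize_idTail (n j : ℕ) (x y : Fin n → ℝ) (hx : ∀ i, 0 ≤ x i) (hy : ∀ i, 0 ≤ y i) :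
    (idTail n j).realize (Fin.append x y) = x - y := by
  induction j with
  | zero => simp [idTail, realize, stackCols_mulVec, sub_eq_add_neg, Matrix.neg_mulVec]
  | succ j ih =>
    simp only [idTail, realize, Matrix.one_mulVec, add_zero]
    rw [relu_append]
    simpa [hx, hy] using ih

lemma depth_idTail (n j : ℕ) : (idTail n j).depth = j + 1 := by
  induction j with
  | zero => rfl
  | succ j ih => simp [idTail, depth, ih]

lemma weights_idTail (n j : ℕ) : (idTail n j).weights = 2 * n * (j + 1) := by
  induction j with
  | zero => simp [idTail, weights, nnzMat_stackCols]; ring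
  | succ j ih => simp [idTail, weights, ih]; ring

lemma lastWeights_idTail (n j : ℕ) : (idTail n j).lastWeights = 2 * n := by
  induction j with
  | zero => simp [idTail, lastWeights, nnzMat_stackCols]; ring
  | succ j ih => simpa [idTail, lastWeights] using ih

lemma realize_idNet (n L : ℕ) (x : Fin n → ℝ) : (idNet n L).realize x = x := by
  match L with
  | 0 => simp [idNet, realize]
  | 1 => simp [idNet, realize]
  | j + 2 =>
    simp only [idNet, realize, stackRows_mulVec, Matrix.one_mulVec, Matrix.neg_mulVec, add_zero]
    rw [relu_append, realize_idTail _ _ _ _ (by simp) (by simp)]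
    ext i
    rcases le_total 0 (x i) with h | h <;> simp [h]

lemma depth_idNet (n : ℕ) {L : ℕ} (hL : 1 ≤ L) : (idNet n L).depth = L := by
  match L, hL with
  | 1, _ => rfl
  | j + 2, _ => simp [idNet, depth, depth_idTail]

lemma weights_idNet_le (n : ℕ) {L : ℕ} (hL : 1 ≤ L) : (idNet n L).weights ≤ 2 * n * L := by
  match L, hL with
  | 1, _ => simp [idNet, weights]; omega
  | j + 2, _ => simp [idNet, weights, weights_idTail, nnzMat_stackRows]; ring_nf; omega

lemma firstWeights_idNet_le (n : ℕ) (L : ℕ) : (idNet n L).firstWeights ≤ 2 * n := by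
  match L with
  | 0 => simp [idNet, firstWeights]; omega
  | 1 => simp [idNet, firstWeights]; omega
  | j + 2 => simp [idNet, firstWeights, nnzMat_stackRows]; omega

lemma lastWeights_idNet_le (n : ℕ) (L : ℕ) : (idNet n L).lastWeights ≤ 2 * n := by
  match L with
  | 0 => simp [idNet, lastWeights]; omega
  | 1 => simp [idNet, lastWeights]; omega
  | j + 2 => simp [idNet, lastWeights, lastWeights_idTail]

/-! ### Sparse concatenation -/

lemma sparseConcat_last {m k n : ℕ} (Φ₁ : NN k n) (A : Matrix (Fin k) (Fin m) ℝ) (b : Fin k → ℝ) :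
    sparseConcat Φ₁ (last A b) = layer (stackRows A (-A)) (Fin.append b (-b))
      (preAffine Φ₁ (stackCols 1 (-1)) 0) := by
  simp [sparseConcat, idNet, idTail, concat, preAffine, stackRows_one_neg_one_mul,
    stackRows_mulVec, Matrix.neg_mulVec]

lemma sparseConcat_layer {m k l n : ℕ} (Φ₁ : NN k n) (A : Matrix (Fin l) (Fin m) ℝ)
    (b : Fin l → ℝ) (Φ₂ : NN l k) :
    sparseConcat Φ₁ (layer A b Φ₂) = layer A b (sparseConcat Φ₁ Φ₂) := rfl

lemma realize_sparseConcat {m k n : ℕ} (Φ₁ : NN k n) (Φ₂ : NN m k) (x : Fin m → ℝ) :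
    (sparseConcat Φ₁ Φ₂).realize x = Φ₁.realize (Φ₂.realize x) := by
  rw [sparseConcat, realize_concat, realize_concat, realize_idNet]

lemma depth_sparseConcat {m k n : ℕ} (Φ₁ : NN k n) (Φ₂ : NN m k) :
    (sparseConcat Φ₁ Φ₂).depth = Φ₁.depth + Φ₂.depth := by
  have h1 := depth_concat_add_one Φ₁ (concat (idNet k 2) Φ₂)
  have h2 := depth_concat_add_one (idNet k 2) Φ₂
  rw [depth_idNet k (by norm_num)] at h2
  rw [sparseConcat]; omega

lemma weights_preAffine_stackCols_le {k n : ℕ} (Φ : NN k n) :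
    (preAffine Φ (stackCols (1 : Matrix (Fin k) (Fin k) ℝ) (-1 : Matrix (Fin k) (Fin k) ℝ)) 0).weights ≤ Φ.weights + Φ.firstWeights := by
  cases Φ <;>
    simp [preAffine, weights, firstWeights, mul_stackCols_one_neg_one, nnzMat_stackCols] <;> omega

lemma lastWeights_preAffine_stackCols_le {k n : ℕ} (Φ : NN k n) :
    (preAffine Φ (stackCols (1 : Matrix (Fin k) (Fin k) ℝ) (-1 : Matrix (Fin k) (Fin k) ℝ)) 0).lastWeights ≤ 2 * Φ.lastWeights := by
  cases Φ <;>
    simp [preAffine, lastWeights, mul_stackCols_one_neg_one, nnzMat_stackCols] <;> omega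

/-- The inserted identity merges with its neighbours: the last pair `(A, b)` of `Φ₂` is stacked on
its negative, and the first matrix `A` of `Φ₁` becomes `(A | -A)`. Only these two layers are
doubled. -/
lemma weights_sparseConcat_le {m k n : ℕ} (Φ₁ : NN k n) (Φ₂ : NN m k) :
    (sparseConcat Φ₁ Φ₂).weights
      ≤ Φ₁.weights + Φ₁.firstWeights + (Φ₂.weights + Φ₂.lastWeights) := by
  induction Φ₂ with
  | last A b =>
    have := weights_preAffine_stackCols_le Φ₁
    simp only [sparseConcat_last, weights, lastWeights, nnzMat_stackRows, nnzVec_append,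
      nnzMat_neg, nnzVec_neg]
    omega
  | layer A b Φ ih =>
    have := ih Φ₁
    simp only [sparseConcat_layer, weights, lastWeights]
    omega

/-- The factor 2 is needed only when `Φ₁` has a single layer. Since `Φ₂` does not enter, repeated
concatenation does not compound the doubling. -/
lemma lastWeights_sparseConcat_le {m k n : ℕ} (Φ₁ : NN k n) (Φ₂ : NN m k) :
    (sparseConcat Φ₁ Φ₂).lastWeights ≤ 2 * Φ₁.lastWeights := by
  induction Φ₂ with
  | last A b =>
    simpa only [sparseConcat_last, lastWeights] using lastWeights_preAffine_stackCols_le Φ₁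
  | layer A b Φ ih => simpa only [sparseConcat_layer, lastWeights] using ih Φ₁

/-- A linear output layer in sparse concatenation. -/
lemma weights_sparseConcat_last_zero_le {m k n : ℕ} (A : Matrix (Fin n) (Fin k) ℝ) (Φ : NN m k) :
    (sparseConcat (last A 0) Φ).weights ≤ 2 * n * k + 2 * Φ.weights := by
  refine (weights_sparseConcat_le _ _).trans ?_
  have h1 := nnzMat_le A
  have h2 := lastWeights_le Φ
  simp only [weights, firstWeights, nnzVec_zero, mul_assoc]
  omega

lemma weights_concat_smul_le {m n : ℕ} (a : ℝ) (Φ : NN m n) :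
    (concat (last (a • (1 : Matrix (Fin n) (Fin n) ℝ)) 0) Φ).weights ≤ Φ.weights := by
  induction Φ with
  | last A b =>
    simpa [concat, preAffine, weights, Matrix.smul_mulVec] using
      add_le_add (nnzMat_smul_le a A) (nnzVec_smul_le a b)
  | layer A b Φ ih => simpa only [concat, weights, add_le_add_iff_left] using ih

lemma lastWeights_concat_smul_le {m n : ℕ} (a : ℝ) (Φ : NN m n) :
    (concat (last (a • (1 : Matrix (Fin n) (Fin n) ℝ)) 0) Φ).lastWeights ≤ Φ.lastWeights := by
  induction Φ with
  | last A b =>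
    simpa [concat, preAffine, lastWeights, Matrix.smul_mulVec] using
      add_le_add (nnzMat_smul_le a A) (nnzVec_smul_le a b)
  | layer A b Φ ih => simpa only [concat, lastWeights] using ih

lemma weights_concat_neg_le {m n : ℕ} (c : Fin n → ℝ) (Φ : NN m n) :
    (concat (last (-1 : Matrix (Fin n) (Fin n) ℝ) c) Φ).weights ≤ Φ.weights + nnzVec c := by
  induction Φ with
  | last A b =>
    have := nnzVec_add_le (-b) c
    simp [concat, preAffine, weights, Matrix.neg_mulVec] at this ⊢
    omega
  | layer A b Φ ih => have := ih c; simp only [concat, weights]; omega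

lemma lastWeights_concat_neg_le {m n : ℕ} (c : Fin n → ℝ) (Φ : NN m n) :
    (concat (last (-1 : Matrix (Fin n) (Fin n) ℝ) c) Φ).lastWeights ≤ Φ.lastWeights + nnzVec c := by
  induction Φ with
  | last A b =>
    have := nnzVec_add_le (-b) c
    simp [concat, preAffine, lastWeights, Matrix.neg_mulVec] at this ⊢
    omega
  | layer A b Φ ih => simpa only [concat, lastWeights] using ih c

/-! ### Parallelization -/

lemma realize_sideBySide {m m' n n' : ℕ} (Φ : NN m n) (Φ' : NN m' n') (h : Φ.depth = Φ'.depth)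
    (x : Fin m → ℝ) (x' : Fin m' → ℝ) :
    (sideBySide Φ Φ').realize (Fin.append x x')
      = Fin.append (Φ.realize x) (Φ'.realize x') := by
  induction Φ generalizing m' n' with
  | last A b =>
    cases Φ' with
    | last A' b' => simp [sideBySide, realize, blockDiag_mulVec, append_add_append]
    | layer A' b' Φ' => have := Φ'.depth_pos; simp [depth] at h; omega
  | layer A b Φ ih =>
    cases Φ' with
    | last A' b' => have := Φ.depth_pos; simp [depth] at h; omega
    | layer A' b' Φ' =>
      simp only [depth, add_left_inj] at h
      simp only [sideBySide, realize, blockDiag_mulVec, append_add_append]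
      rw [relu_append, ih Φ' h]

lemma weights_sideBySide {m m' n n' : ℕ} (Φ : NN m n) (Φ' : NN m' n') (h : Φ.depth = Φ'.depth) :
    (sideBySide Φ Φ').weights = Φ.weights + Φ'.weights ∧
      (sideBySide Φ Φ').lastWeights = Φ.lastWeights + Φ'.lastWeights ∧
      (sideBySide Φ Φ').depth = Φ.depth := by
  induction Φ generalizing m' n' with
  | last A b =>
    cases Φ' with
    | last A' b' =>
      simp only [sideBySide, weights, lastWeights, depth, nnzMat_blockDiag, nnzVec_append,
        and_true]
      omega
    | layer A' b' Φ' => have := Φ'.depth_pos; simp [depth] at h; omega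
  | layer A b Φ ih =>
    cases Φ' with
    | last A' b' => have := Φ.depth_pos; simp [depth] at h; omega
    | layer A' b' Φ' =>
      simp only [depth, add_left_inj] at h
      have := ih Φ' h
      simp only [sideBySide, weights, lastWeights, depth, nnzMat_blockDiag, nnzVec_append]
      omega

lemma realize_parEq {m n n' : ℕ} (Φ : NN m n) (Φ' : NN m n') (h : Φ.depth = Φ'.depth)
    (x : Fin m → ℝ) :
    (parEq Φ Φ').realize x = Fin.append (Φ.realize x) (Φ'.realize x) := by
  cases Φ with
  | last A b =>
    cases Φ' with
    | last A' b' => simp [parEq, realize, stackRows_mulVec, append_add_append]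
    | layer A' b' Φ' => have := Φ'.depth_pos; simp [depth] at h; omega
  | layer A b Φ =>
    cases Φ' with
    | last A' b' => have := Φ.depth_pos; simp [depth] at h; omega
    | layer A' b' Φ' =>
      simp only [depth, add_left_inj] at h
      simp only [parEq, realize, stackRows_mulVec, append_add_append]
      rw [relu_append, realize_sideBySide _ _ h]

lemma weights_parEq {m n n' : ℕ} (Φ : NN m n) (Φ' : NN m n') (h : Φ.depth = Φ'.depth) :
    (parEq Φ Φ').weights = Φ.weights + Φ'.weights ∧
      (parEq Φ Φ').lastWeights = Φ.lastWeights + Φ'.lastWeights ∧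
      (parEq Φ Φ').depth = Φ.depth := by
  cases Φ with
  | last A b =>
    cases Φ' with
    | last A' b' =>
      simp only [parEq, weights, lastWeights, depth, nnzMat_stackRows, nnzVec_append, and_true]
      omega
    | layer A' b' Φ' => have := Φ'.depth_pos; simp [depth] at h; omega
  | layer A b Φ =>
    cases Φ' with
    | last A' b' => have := Φ.depth_pos; simp [depth] at h; omega
    | layer A' b' Φ' =>
      simp only [depth, add_left_inj] at h
      have := weights_sideBySide Φ Φ' h
      simp only [parEq, weights, lastWeights, depth, nnzMat_stackRows, nnzVec_append]
      omega

lemma realize_extend {m n : ℕ} (L : ℕ) (Φ : NN m n) (x : Fin m → ℝ) :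
    (extend L Φ).realize x = Φ.realize x := by
  rw [extend]
  split
  · rfl
  · rw [realize_sparseConcat, realize_idNet]

lemma depth_extend {m n : ℕ} {L : ℕ} (Φ : NN m n) (h : Φ.depth ≤ L) :
    (extend L Φ).depth = L := by
  rw [extend]
  split
  · assumption
  · rw [depth_sparseConcat, depth_idNet _ (by omega)]; omega

/-- The combination `weights + lastWeights` is what a later sparse concatenation charges; bounding
it as a whole leaves the factor in front of the given networks at 2. -/
lemma weights_extend_le {m n : ℕ} {L : ℕ} (Φ : NN m n) (h : Φ.depth ≤ L) :
    (extend L Φ).weights + (extend L Φ).lastWeights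
      ≤ Φ.weights + Φ.lastWeights + 8 * n * L := by
  rw [extend]
  split
  · omega
  · have h1 := weights_sparseConcat_le (idNet n (L - Φ.depth)) Φ
    have h2 := lastWeights_sparseConcat_le (idNet n (L - Φ.depth)) Φ
    have h3 := weights_idNet_le n (L := L - Φ.depth) (by omega)
    have h4 := firstWeights_idNet_le n (L - Φ.depth)
    have h5 := lastWeights_idNet_le n (L - Φ.depth)
    have h6 : 2 * n * (L - Φ.depth) ≤ 2 * n * L := by gcongr; omega
    -- Absorbs the `6n` from the first layer and the doubled last layer of the identity network;
    -- together with `h6` this gives `8nL`.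
    have h7 : n * 1 ≤ n * L := by have := Φ.depth_pos; gcongr; omega
    nlinarith

lemma realize_par {m n n' : ℕ} (Φ : NN m n) (Φ' : NN m n') (x : Fin m → ℝ) :
    (par Φ Φ').realize x = Fin.append (Φ.realize x) (Φ'.realize x) := by
  rw [par, realize_parEq, realize_extend, realize_extend]
  rw [depth_extend _ (le_max_left _ _), depth_extend _ (le_max_right _ _)]

lemma depth_par {m n n' : ℕ} (Φ : NN m n) (Φ' : NN m n') :
    (par Φ Φ').depth = max Φ.depth Φ'.depth := by
  have h := (depth_extend Φ (le_max_left _ Φ'.depth)).trans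
    (depth_extend Φ' (le_max_right Φ.depth _)).symm
  rw [par, (weights_parEq _ _ h).2.2, depth_extend _ (le_max_left _ _)]

lemma weights_par_le {m n n' : ℕ} (Φ : NN m n) (Φ' : NN m n') :
    (par Φ Φ').weights + (par Φ Φ').lastWeights
      ≤ Φ.weights + Φ.lastWeights + (Φ'.weights + Φ'.lastWeights)
        + 8 * (n + n') * max Φ.depth Φ'.depth := by
  have h := (depth_extend Φ (le_max_left _ Φ'.depth)).trans
    (depth_extend Φ' (le_max_right Φ.depth _)).symm
  have h1 := weights_extend_le Φ (le_max_left _ Φ'.depth)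
  have h2 := weights_extend_le Φ' (le_max_right Φ.depth _)
  rw [par, (weights_parEq _ _ h).1, (weights_parEq _ _ h).2.1]
  nlinarith

end NN

/-! ### A network that computes products -/

/-- The vector that consists of `q` blocks of length three. -/
def pack {q : ℕ} (h : Fin q → Fin 3 → ℝ) : Fin (q * 3) → ℝ :=
  fun c => h (finProdFinEquiv.symm c).1 (finProdFinEquiv.symm c).2

/-- The block diagonal matrix with `q` diagonal blocks `N`. -/
def copies (q : ℕ) (N : Matrix (Fin 3) (Fin 3) ℝ) : Matrix (Fin (q * 3)) (Fin (q * 3)) ℝ :=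
  Matrix.of fun c c' =>
    if (finProdFinEquiv.symm c).1 = (finProdFinEquiv.symm c').1 then
      N (finProdFinEquiv.symm c).2 (finProdFinEquiv.symm c').2 else 0

lemma sum_fin_mul {M : Type*} [AddCommMonoid M] {q r : ℕ} (F : Fin (q * r) → M) :
    ∑ c, F c = ∑ j, ∑ l, F (finProdFinEquiv (j, l)) := by
  rw [← Fintype.sum_prod_type' (fun j l => F (finProdFinEquiv (j, l)))]
  exact (Equiv.sum_comp finProdFinEquiv F).symm

lemma copies_mulVec_pack {q : ℕ} (N : Matrix (Fin 3) (Fin 3) ℝ) (h : Fin q → Fin 3 → ℝ) :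
    copies q N *ᵥ pack h = pack fun j => N *ᵥ h j := by
  ext c
  obtain ⟨⟨j, l⟩, rfl⟩ := finProdFinEquiv.surjective c
  simp only [copies, pack, Matrix.mulVec, dotProduct, sum_fin_mul, Matrix.of_apply,
    Equiv.symm_apply_apply, ite_mul, zero_mul, Finset.sum_ite_irrel, Finset.sum_const_zero,
    Finset.sum_ite_eq, Finset.mem_univ, if_true]

lemma nnzMat_copies_le (q : ℕ) (N : Matrix (Fin 3) (Fin 3) ℝ) :
    nnzMat (copies q N) ≤ q * 3 * 3 := by
  refine nnzMat_le_of_rows _ fun c => ?_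
  rw [nnzVec_eq_sum, sum_fin_mul]
  calc _ ≤ ∑ j : Fin q, ∑ _l : Fin 3, if (finProdFinEquiv.symm c).1 = j then 1 else 0 := by
        refine Finset.sum_le_sum fun j _ => Finset.sum_le_sum fun l _ => ?_
        simp only [copies, Matrix.of_apply, Equiv.symm_apply_apply]
        by_cases h : (finProdFinEquiv.symm c).1 = j
        · simp only [h, if_true]; split <;> simp
        · simp only [h, if_false, if_true, le_refl]
    _ = 3 := by rw [Finset.sum_comm]; simp

/-- The weights of one step `(g, g - 1/2, c) ↦ (g', g' - 1/2, 4 c + g')` for the tent map `g'`. -/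
def tentMat : Matrix (Fin 3) (Fin 3) ℝ := !![2, -4, 0; 2, -4, 0; 2, -4, 4]

/-- The bias of one tent step. -/
noncomputable def tentBias : Fin 3 → ℝ := ![0, -1 / 2, 0]

/-- One hidden layer that performs a tent step. -/
noncomputable def tentStep (h : Fin 3 → ℝ) : Fin 3 → ℝ :=
  fun i => max ((tentMat *ᵥ h + tentBias) i) 0

lemma tentStep_apply (h : Fin 3 → ℝ) :
    tentStep h = ![max (2 * h 0 - 4 * h 1) 0, max (2 * h 0 - 4 * h 1 - 1 / 2) 0,
      max (4 * h 2 + (2 * h 0 - 4 * h 1)) 0] := by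
  ext i
  fin_cases i
  · simp [tentStep, tentMat, tentBias, dotProduct, Fin.sum_univ_three]; ring_nf
  · simp [tentStep, tentMat, tentBias, dotProduct, Fin.sum_univ_three]; ring_nf
  · simp [tentStep, tentMat, tentBias, dotProduct, Fin.sum_univ_three]; ring_nf

/-- Iterated tent steps approximate the parabola `z (1 - z)`. -/
lemma abs_tentStep_iterate_sub_le (T : ℕ) {z c : ℝ} (hz : 0 ≤ z) (hz' : z ≤ 1) (hc : 0 ≤ c) :
    |(tentStep^[T] ![z, max (z - 1 / 2) 0, c]) 2 - 4 ^ T * (c + z * (1 - z))| ≤ 1 / 4 := by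
  induction T generalizing z c with
  | zero =>
    simp only [Function.iterate_zero, id_eq, Matrix.cons_val, pow_zero, one_mul]
    -- With no tent step the error is the parabola itself, whose maximum is `1/4`.
    rw [abs_le]; constructor <;> nlinarith [sq_nonneg (z - 1 / 2)]
  | succ T ih =>
    -- Both branches of the tent map satisfy `g + g (1 - g) = 4 z (1 - z)`. Storing the accumulator
    -- multiplied by `4^T` keeps the error at `1/4` through the induction.
    have key : ∀ g : ℝ, g = 2 * z - 4 * max (z - 1 / 2) 0 → 0 ≤ g → g ≤ 1 →
        g + g * (1 - g) = 4 * (z * (1 - z)) →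
        |(tentStep^[T + 1] ![z, max (z - 1 / 2) 0, c]) 2 - 4 ^ (T + 1) * (c + z * (1 - z))|
          ≤ 1 / 4 := by
      intro g hg h0 h1 hh
      have := ih h0 h1 (c := 4 * c + g) (by positivity)
      rw [Function.iterate_succ_apply, tentStep_apply]
      simp only [Matrix.cons_val, ← hg]
      rw [max_eq_left h0, max_eq_left (by positivity : 0 ≤ 4 * c + g)]
      convert this using 2
      rw [pow_succ]
      linear_combination (4 : ℝ) ^ T * hh
    rcases le_total z (1 / 2) with h | h
    · refine key (2 * z) ?_ (by linarith) (by linarith) (by ring)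
      rw [max_eq_right (by linarith)]; ring
    · refine key (2 - 2 * z) ?_ (by linarith) (by linarith) (by ring)
      rw [max_eq_left (by linarith)]; ring

/-- `T` tent steps in `q` copies, followed by a linear layer. -/
noncomputable def tentTail {q k : ℕ} (A : Matrix (Fin k) (Fin q) ℝ) : ℕ → NN (q * 3) k
  | 0 => NN.last (Matrix.of fun i c =>
      if (finProdFinEquiv.symm c).2 = 2 then A i (finProdFinEquiv.symm c).1 else 0) 0
  | T + 1 => NN.layer (copies q tentMat) (pack fun _ => tentBias) (tentTail A T)

lemma realize_tentTail {q k : ℕ} (A : Matrix (Fin k) (Fin q) ℝ) (T : ℕ)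
    (h : Fin q → Fin 3 → ℝ) :
    (tentTail A T).realize (pack h) = A *ᵥ fun j => (tentStep^[T] (h j)) 2 := by
  induction T generalizing h with
  | zero =>
    ext i
    simp [tentTail, NN.realize, Matrix.mulVec, dotProduct, sum_fin_mul, pack,
      -finProdFinEquiv_symm_apply]
  | succ T ih =>
    simp only [tentTail, NN.realize, copies_mulVec_pack]
    exact ih fun j => tentStep (h j)

lemma depth_tentTail {q k : ℕ} (A : Matrix (Fin k) (Fin q) ℝ) (T : ℕ) :
    (tentTail A T).depth = T + 1 := by
  induction T with
  | zero => rfl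
  | succ T ih => simp [tentTail, NN.depth, ih]

/-- The hypothesis on the columns says that each copy feeds at most one output; without it the last
layer could cost `k q` weights. -/
lemma weights_tentTail_le {q k : ℕ} (A : Matrix (Fin k) (Fin q) ℝ)
    (hA : ∀ j, nnzVec (Aᵀ j) ≤ 1) (T : ℕ) :
    (tentTail A T).weights ≤ q * 3 + 12 * q * T := by
  induction T with
  | zero =>
    simp only [tentTail, NN.weights, nnzVec_zero, add_zero, mul_zero]
    rw [← nnzMat_transpose]
    refine (nnzMat_le_of_rows (c := 1) _ fun c => ?_).trans (by simp)
    by_cases hc : (finProdFinEquiv.symm c).2 = 2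
    · convert hA (finProdFinEquiv.symm c).1 using 2
      ext i; simp only [Matrix.transpose_apply, Matrix.of_apply, hc, if_true]
    · have : (Matrix.of fun (i : Fin k) (c : Fin (q * 3)) =>
        if (finProdFinEquiv.symm c).2 = 2 then A i (finProdFinEquiv.symm c).1 else 0)ᵀ c = 0 := by
        ext i; simp only [Matrix.transpose_apply, Matrix.of_apply, hc, if_false, Pi.zero_apply]
      rw [this]; simp
  | succ T ih =>
    simp only [tentTail, NN.weights]
    have h1 := nnzMat_copies_le q tentMat
    have h2 := nnzVec_le (pack fun _ : Fin q => tentBias)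
    nlinarith

lemma nnzVec_single_le {n : ℕ} (i : Fin n) (a : ℝ) : nnzVec (Pi.single i a : Fin n → ℝ) ≤ 1 := by
  rw [nnzVec_eq_sum]
  calc _ ≤ ∑ j : Fin n, if j = i then 1 else 0 := by
        refine Finset.sum_le_sum fun j _ => ?_
        by_cases h : j = i
        · simp only [h, if_true]; split <;> simp
        · simp [h]
    _ = 1 := by simp

/-- The sign belonging to a Boolean. -/
def boolSign (s : Bool) : ℝ := if s then 1 else -1

/-- The polarisation identity for the parabola `z (1 - z)`, with errors. -/
lemma abs_polarisation_sub_le {K x y c₁ c₂ t : ℝ} (hK : 0 < K) (ht : 0 < t)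
    (h₁ : |c₁ - t * (0 + (1 / 2 + (x + y) / (2 * K)) * (1 - (1 / 2 + (x + y) / (2 * K))))|
      ≤ 1 / 4)
    (h₂ : |c₂ - t * (0 + (1 / 2 + (x - y) / (2 * K)) * (1 - (1 / 2 + (x - y) / (2 * K))))|
      ≤ 1 / 4) :
    |K ^ 2 / t * (c₂ - c₁) - x * y| ≤ K ^ 2 / (2 * t) := by
  have e : K ^ 2 / t * (c₂ - c₁) - x * y = K ^ 2 / t *
      ((c₂ - t * (0 + (1 / 2 + (x - y) / (2 * K)) * (1 - (1 / 2 + (x - y) / (2 * K)))))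
      - (c₁ - t * (0 + (1 / 2 + (x + y) / (2 * K)) * (1 - (1 / 2 + (x + y) / (2 * K)))))) := by
    field_simp; ring
  rw [e, abs_mul, abs_of_pos (by positivity)]
  calc _ ≤ K ^ 2 / t * (1 / 4 + 1 / 4) := by
        gcongr; exact (abs_sub _ _).trans (add_le_add h₂ h₁)
    _ = _ := by field_simp; ring

/-- A network that approximates finitely many products of pairs of inputs and adds them up. -/
theorem exists_productNet {n k : ℕ} {J : Type*} [Fintype J] (ix iy : J → Fin n) (bx : J → ℝ)
    (o : J → Fin k) {K : ℝ} (hK : 0 < K) (T : ℕ) :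
    ∃ Φ : NN n k, Φ.depth = T + 2 ∧ Φ.weights ≤ 24 * Fintype.card J * (T + 1) ∧
      ∀ v : Fin n → ℝ, (∀ j, |v (ix j) + bx j| ≤ K / 2) → (∀ j, |v (iy j)| ≤ K / 2) →
        ∀ i, |Φ.realize v i - ∑ j with o j = i, (v (ix j) + bx j) * v (iy j)|
          ≤ (Finset.univ.filter fun j => o j = i).card * (K ^ 2 / (2 * 4 ^ T)) := by
  classical
  set q := Fintype.card (J × Bool) with hq
  have hqc : q = 2 * Fintype.card J := by
    rw [hq, Fintype.card_prod, Fintype.card_bool, mul_comm]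
  let e : Fin q ≃ J × Bool := (Fintype.equivFin (J × Bool)).symm
  -- The copies come in pairs, one for `x + y` and one for `x - y`. The sign implements `h z₋ - h
  -- z₊`, and `K² / 4^T` undoes the scaling of the tent accumulator.
  let A : Matrix (Fin k) (Fin q) ℝ := Matrix.of fun i c =>
    (Pi.single (o (e c).1) (-(boolSign (e c).2 * (K ^ 2 / 4 ^ T))) : Fin k → ℝ) i
  let R : Fin q → Fin n → ℝ := fun c =>
    Pi.single (ix (e c).1) (1 / (2 * K)) + Pi.single (iy (e c).1) (boolSign (e c).2 / (2 * K))
  -- The first two slots of a copy receive `z` and `z - 1/2`; the third is the accumulator and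
  -- starts at 0.
  let B : Matrix (Fin (q * 3)) (Fin n) ℝ := Matrix.of fun c i =>
    if (finProdFinEquiv.symm c).2 = 2 then 0 else R (finProdFinEquiv.symm c).1 i
  let w : Fin (q * 3) → ℝ := pack fun c =>
    ![1 / 2 + bx (e c).1 / (2 * K), bx (e c).1 / (2 * K), 0]
  have hR : ∀ c, nnzVec (R c) ≤ 2 := fun c =>
    (nnzVec_add_le _ _).trans (add_le_add (nnzVec_single_le _ _) (nnzVec_single_le _ _))
  refine ⟨NN.layer B w (tentTail A T), ?_, ?_, ?_⟩
  · simp [NN.depth, depth_tentTail]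
  · have h1 : nnzMat B ≤ q * 3 * 2 := by
      refine nnzMat_le_of_rows _ fun c => ?_
      by_cases hc : (finProdFinEquiv.symm c).2 = 2
      · have : B c = 0 := by ext i; simp only [B, Matrix.of_apply, hc, if_true, Pi.zero_apply]
        rw [this]; simp
      · have : B c = R (finProdFinEquiv.symm c).1 := by
          ext i; simp only [B, Matrix.of_apply, hc, if_false]
        rw [this]; exact hR _
    have h2 := nnzVec_le w
    have h3 := weights_tentTail_le A (fun c => nnzVec_single_le _ _) T
    simp only [NN.weights]
    have h4 : 12 * q * (T + 1) = 24 * Fintype.card J * (T + 1) := by rw [hqc]; ring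
    linarith
  · intro v hx hy i
    let z : J × Bool → ℝ := fun js =>
      1 / 2 + (v (ix js.1) + bx js.1 + boolSign js.2 * v (iy js.1)) / (2 * K)
    have hB : (fun c => max ((B *ᵥ v + w) c) 0)
        = pack fun c => ![max (z (e c)) 0, max (z (e c) - 1 / 2) 0, 0] := by
      ext c
      obtain ⟨⟨j, l⟩, rfl⟩ := finProdFinEquiv.surjective c
      have hRv : R j ⬝ᵥ v
          = (v (ix (e j).1) + boolSign (e j).2 * v (iy (e j).1)) / (2 * K) := by
        simp only [R, add_dotProduct, single_dotProduct]; ring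
      fin_cases l
      · simp only [Matrix.mulVec, Pi.add_apply, B, w, pack, Matrix.of_apply, z,
          Equiv.symm_apply_apply]
        simp [dotProduct, -finProdFinEquiv_symm_apply] at hRv ⊢
        rw [hRv]; ring_nf
      · simp only [Matrix.mulVec, Pi.add_apply, B, w, pack, Matrix.of_apply, z,
          Equiv.symm_apply_apply]
        simp [dotProduct, -finProdFinEquiv_symm_apply] at hRv ⊢
        rw [hRv]; ring_nf
      · simp [Matrix.mulVec, dotProduct, B, w, pack, -finProdFinEquiv_symm_apply]
    -- This is where the bound `K / 2` on both factors is needed: the tent iteration only works on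
    -- `[0, 1]`.
    have hz : ∀ js, 0 ≤ z js ∧ z js ≤ 1 := by
      rintro ⟨j, s⟩
      have h1 := abs_le.1 (hx j)
      have h2 := abs_le.1 (hy j)
      have h3 : |(v (ix j) + bx j + boolSign s * v (iy j)) / (2 * K)| ≤ 1 / 2 := by
        rw [abs_div, abs_of_pos (by positivity : 0 < 2 * K), div_le_iff₀ (by positivity), abs_le]
        cases s <;> simp [boolSign] <;> constructor <;> linarith
      have h4 := abs_le.1 h3
      simp only [z]
      constructor <;> linarith
    let c : J × Bool → ℝ := fun js => (tentStep^[T] ![z js, max (z js - 1 / 2) 0, 0]) 2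
    have hc : ∀ js, |c js - 4 ^ T * (0 + z js * (1 - z js))| ≤ 1 / 4 := fun js =>
      abs_tentStep_iterate_sub_le T (hz js).1 (hz js).2 le_rfl
    have hreal : (NN.layer B w (tentTail A T)).realize v i
        = ∑ j with o j = i, K ^ 2 / 4 ^ T * (c (j, false) - c (j, true)) := by
      rw [NN.realize, hB, realize_tentTail]
      simp only [max_eq_left (hz _).1]
      change ∑ a, A i a * c (e a) = _
      let F : J × Bool → ℝ := fun js =>
        (if o js.1 = i then -(boolSign js.2 * (K ^ 2 / 4 ^ T)) else 0) * c js
      have hF : ∀ a, A i a * c (e a) = F (e a) := by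
        intro a
        simp only [F, A, Matrix.of_apply, Pi.single_apply, eq_comm]
      rw [Finset.sum_congr rfl fun a _ => hF a, Equiv.sum_comp e F, Fintype.sum_prod_type,
        Finset.sum_filter]
      refine Finset.sum_congr rfl fun j _ => ?_
      by_cases h : o j = i
      · simp [F, h, boolSign]; ring
      · simp [F, h]
    rw [hreal, ← Finset.sum_sub_distrib]
    refine (Finset.abs_sum_le_sum_abs _ _).trans ?_
    rw [← nsmul_eq_mul]
    refine Finset.sum_le_card_nsmul _ _ _ fun j _ => ?_
    have h1 := hc (j, true)
    have h2 := hc (j, false)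
    simp only [z, boolSign, if_true, one_mul, Bool.false_eq_true, if_false, neg_mul,
      ← sub_eq_add_neg] at h1 h2
    exact abs_polarisation_sub_le hK (by positivity) h1 h2

/-! ### Euclidean and spectral norms -/

section Norms

open scoped Matrix.Norms.L2Operator

variable {m n k : ℕ}

lemma euclid_nonneg (v : Fin n → ℝ) : 0 ≤ euclid v := norm_nonneg _

lemma euclid_sq (v : Fin n → ℝ) : euclid v ^ 2 = ∑ i, v i ^ 2 := by
  simp [euclid, EuclideanSpace.norm_sq_eq]

lemma euclid_sq_eq_dotProduct (v : Fin n → ℝ) : euclid v ^ 2 = v ⬝ᵥ v := by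
  rw [euclid_sq, dotProduct]; exact Finset.sum_congr rfl fun i _ => sq (v i)

lemma euclid_add_le (v w : Fin n → ℝ) : euclid (v + w) ≤ euclid v + euclid w := by
  simpa [euclid] using norm_add_le (WithLp.toLp 2 v) (WithLp.toLp 2 w)

lemma euclid_sub_le (v w : Fin n → ℝ) : euclid (v - w) ≤ euclid v + euclid w := by
  simpa [euclid] using norm_sub_le (WithLp.toLp 2 v) (WithLp.toLp 2 w)

lemma euclid_sub_comm (v w : Fin n → ℝ) : euclid (v - w) = euclid (w - v) := by
  simpa [euclid] using norm_sub_rev (WithLp.toLp 2 v) (WithLp.toLp 2 w)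

lemma euclid_le_add_sub (v w : Fin n → ℝ) : euclid w ≤ euclid v + euclid (v - w) := by
  have := euclid_sub_le v (v - w)
  rwa [sub_sub_cancel] at this

lemma abs_dotProduct_le (v w : Fin n → ℝ) : |v ⬝ᵥ w| ≤ euclid v * euclid w := by
  have := abs_real_inner_le_norm (WithLp.toLp 2 w) (WithLp.toLp 2 v)
  rw [mul_comm]
  simpa [euclid, EuclideanSpace.inner_eq_star_dotProduct] using this

lemma abs_apply_le_euclid (v : Fin n → ℝ) (i : Fin n) : |v i| ≤ euclid v := by
  simpa [euclid] using PiLp.norm_apply_le (WithLp.toLp 2 v) i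

lemma euclid_le_of_abs_le {v : Fin n → ℝ} {η : ℝ} (h : ∀ i, |v i| ≤ η) : euclid v ≤ n * η := by
  rcases Nat.eq_zero_or_pos n with rfl | hn
  · simp [euclid, EuclideanSpace.norm_eq]
  have hη : 0 ≤ η := (abs_nonneg _).trans (h ⟨0, hn⟩)
  have h1 : (1 : ℝ) ≤ n := by exact_mod_cast hn
  refine abs_le_of_sq_le_sq' ?_ (by positivity) |>.2
  rw [euclid_sq]
  calc ∑ i, v i ^ 2 ≤ ∑ _i : Fin n, η ^ 2 :=
        Finset.sum_le_sum fun i _ => sq_le_sq' (abs_le.1 (h i)).1 (abs_le.1 (h i)).2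
    _ = n * η ^ 2 := by simp
    _ ≤ (n * η) ^ 2 := by rw [mul_pow, sq (n : ℝ)]; gcongr; nlinarith

lemma specNorm_nonneg (A : Matrix (Fin m) (Fin n) ℝ) : 0 ≤ specNorm A := norm_nonneg A

lemma euclid_mulVec_le (A : Matrix (Fin m) (Fin n) ℝ) (v : Fin n → ℝ) :
    euclid (A *ᵥ v) ≤ specNorm A * euclid v :=
  Matrix.l2_opNorm_mulVec A (WithLp.toLp 2 v)

lemma specNorm_le_of_forall {A : Matrix (Fin m) (Fin n) ℝ} {c : ℝ} (hc : 0 ≤ c)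
    (h : ∀ v, euclid (A *ᵥ v) ≤ c * euclid v) : specNorm A ≤ c := by
  rw [specNorm, Matrix.l2_opNorm_def]
  exact ContinuousLinearMap.opNorm_le_bound _ hc fun v => h v.ofLp

lemma specNorm_add_le (A B : Matrix (Fin m) (Fin n) ℝ) :
    specNorm (A + B) ≤ specNorm A + specNorm B := norm_add_le A B

lemma specNorm_sub_le (A B : Matrix (Fin m) (Fin n) ℝ) :
    specNorm (A - B) ≤ specNorm A + specNorm B := norm_sub_le A B

lemma specNorm_sub_comm (A B : Matrix (Fin m) (Fin n) ℝ) :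
    specNorm (A - B) = specNorm (B - A) := norm_sub_rev A B

lemma specNorm_mul_le (A : Matrix (Fin m) (Fin n) ℝ) (B : Matrix (Fin n) (Fin k) ℝ) :
    specNorm (A * B) ≤ specNorm A * specNorm B := Matrix.l2_opNorm_mul A B

lemma specNorm_smul (a : ℝ) (A : Matrix (Fin m) (Fin n) ℝ) :
    specNorm (a • A) = |a| * specNorm A := by
  rw [specNorm, norm_smul]; rfl

lemma specNorm_one_le : specNorm (1 : Matrix (Fin n) (Fin n) ℝ) ≤ 1 :=
  specNorm_le_of_forall zero_le_one fun v => by simp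

lemma abs_apply_le_specNorm (A : Matrix (Fin m) (Fin n) ℝ) (i : Fin m) (j : Fin n) :
    |A i j| ≤ specNorm A := by
  have h := (abs_apply_le_euclid _ i).trans (euclid_mulVec_le A (Pi.single j 1))
  simpa [euclid] using h

/-- Cauchy–Schwarz on the rows. The powers of the dimension are cruder than necessary, but they
enter the final bounds only through `log₂ d`. -/
lemma specNorm_le_of_abs_le {A : Matrix (Fin m) (Fin n) ℝ} {η : ℝ} (hη : 0 ≤ η)
    (h : ∀ i j, |A i j| ≤ η) : specNorm A ≤ m * (n * η) := by
  refine specNorm_le_of_forall (by positivity) fun v => ?_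
  rw [mul_assoc]
  refine euclid_le_of_abs_le fun i => ?_
  refine (abs_dotProduct_le (A i) v).trans ?_
  gcongr
  · exact euclid_nonneg v
  · exact euclid_le_of_abs_le (h i)

/-- A matrix that is bounded from below is invertible, with a bound on the inverse. -/
lemma isUnit_of_le_euclid_mulVec {A : Matrix (Fin n) (Fin n) ℝ} {c : ℝ} (hc : 0 < c)
    (h : ∀ v, c * euclid v ≤ euclid (A *ᵥ v)) : IsUnit A ∧ specNorm A⁻¹ ≤ c⁻¹ := by
  have hu : IsUnit A := by
    rw [← Matrix.mulVec_injective_iff_isUnit]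
    intro v w hvw
    have h1 := h (v - w)
    rw [Matrix.mulVec_sub, sub_eq_zero.2 hvw] at h1
    have h0 : euclid (0 : Fin n → ℝ) = 0 := by simp [euclid]
    rw [h0] at h1
    have h2 : euclid (v - w) = 0 :=
      le_antisymm (nonpos_of_mul_nonpos_right h1 hc) (euclid_nonneg _)
    rw [euclid, norm_eq_zero] at h2
    exact sub_eq_zero.1 (congrArg WithLp.ofLp h2)
  refine ⟨hu, specNorm_le_of_forall (by positivity) fun v => ?_⟩
  have h1 := h (A⁻¹ *ᵥ v)
  rw [Matrix.mulVec_mulVec, Matrix.mul_nonsing_inv _ ((Matrix.isUnit_iff_isUnit_det _).1 hu),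
    Matrix.one_mulVec] at h1
  rwa [inv_mul_eq_div, le_div_iff₀ hc, mul_comm]

/-- By the triangle inequality `1 - A` shrinks no vector by more than the factor `1 - r`. -/
lemma isUnit_one_sub {A : Matrix (Fin n) (Fin n) ℝ} {r : ℝ} (hA : specNorm A ≤ r) (hr : r < 1) :
    IsUnit (1 - A) ∧ specNorm (1 - A)⁻¹ ≤ (1 - r)⁻¹ := by
  refine isUnit_of_le_euclid_mulVec (by linarith) fun v => ?_
  have h1 := (euclid_mulVec_le A v).trans
    (mul_le_mul_of_nonneg_right hA (euclid_nonneg v))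
  have h2 := euclid_le_add_sub (A *ᵥ v) v
  rw [Matrix.sub_mulVec, Matrix.one_mulVec, euclid_sub_comm]
  linarith

end Norms

/-! ### Vectorisation -/

lemma vec_apply {d : ℕ} (A : Matrix (Fin d) (Fin d) ℝ) (i j : Fin d) :
    vec A (finProdFinEquiv (j, i)) = A i j := by
  simp [vec, -finProdFinEquiv_symm_apply]

lemma matr_apply {d : ℕ} (v : Fin (d * d) → ℝ) (i j : Fin d) :
    matr v i j = v (finProdFinEquiv (j, i)) := rfl

lemma vec_matr {d : ℕ} (v : Fin (d * d) → ℝ) : vec (matr v) = v := by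
  ext c
  obtain ⟨⟨j, i⟩, rfl⟩ := finProdFinEquiv.surjective c
  rw [vec_apply, matr_apply]

lemma matr_vec {d : ℕ} (A : Matrix (Fin d) (Fin d) ℝ) : matr (vec A) = A := by
  ext i j
  rw [matr_apply, vec_apply]

lemma matr_smul {d : ℕ} (a : ℝ) (v : Fin (d * d) → ℝ) : matr (a • v) = a • matr v := rfl

/-! ### Matrix-vector products -/

/-- One scalar product per matrix entry. The choice `K = 2 Z` admits all factors of absolute value
at most `Z`. Each coordinate sums `d` errors, and passing to the Euclidean norm costs another factor
`d`. -/
theorem exists_multNet (d : ℕ) {Z : ℝ} (hZ : 0 < Z) (T : ℕ) :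
    ∃ Φ : NN (d * d + d) d, Φ.depth = T + 2 ∧ Φ.weights ≤ 24 * d ^ 2 * (T + 1) ∧
      ApproxMult Φ Z (d ^ 2 * (2 * Z ^ 2) / 4 ^ T) := by
  obtain ⟨Φ, h1, h2, h3⟩ := exists_productNet (n := d * d + d) (k := d) (J := Fin d × Fin d)
    (fun j => Fin.castAdd d (finProdFinEquiv (j.2, j.1))) (fun j => Fin.natAdd (d * d) j.2)
    (fun _ => 0) (fun j => j.1) (K := 2 * Z) (by positivity) T
  refine ⟨Φ, h1, by simpa [sq] using h2, fun A w hA hw => ?_⟩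
  have h4 := h3 (Fin.append (vec A) w)
    (fun j => by
      rw [Fin.append_left, vec_apply, add_zero]
      exact (abs_apply_le_specNorm A _ _).trans (by linarith))
    (fun j => by
      rw [Fin.append_right]
      exact (abs_apply_le_euclid w _).trans (by linarith))
  rw [euclid_sub_comm]
  refine (euclid_le_of_abs_le (η := d * ((2 * Z) ^ 2 / (2 * 4 ^ T))) fun i => ?_).trans_eq ?_
  · have h5 := h4 i
    have hfil : (Finset.univ.filter fun j : Fin d × Fin d => j.1 = i)
        = Finset.univ.map ⟨fun k : Fin d => (i, k), Prod.mk_right_injective i⟩ := by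
      ext ⟨a, b⟩
      simp only [Finset.mem_filter, Finset.mem_univ, true_and, Finset.mem_map,
        Function.Embedding.coeFn_mk, Prod.mk.injEq]
      constructor
      · rintro rfl; exact ⟨b, rfl, rfl⟩
      · rintro ⟨_, h, _⟩; exact h.symm
    rw [hfil, Finset.sum_map, Finset.card_map, Finset.card_univ, Fintype.card_fin] at h5
    simp only [Function.Embedding.coeFn_mk, Fin.append_left, Fin.append_right, vec_apply,
      add_zero] at h5
    exact h5
  · field_simp

/-! ### One step of the accelerated Neumann series -/

/-- The first of two matrices that are encoded in a vector. -/
def fstMatr {d : ℕ} (v : Fin (d * d + d * d) → ℝ) : Matrix (Fin d) (Fin d) ℝ :=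
  matr fun c => v (Fin.castAdd _ c)

/-- The second of two matrices that are encoded in a vector. -/
def sndMatr {d : ℕ} (v : Fin (d * d + d * d) → ℝ) : Matrix (Fin d) (Fin d) ℝ :=
  matr fun c => v (Fin.natAdd _ c)

/-- A network for `(P, S) ↦ (P ^ 2, (1 + P) S)`. -/
theorem exists_neumannStepNet (d : ℕ) {Z : ℝ} (hZ : 2 ≤ Z) (T : ℕ) :
    ∃ Φ : NN (d * d + d * d) (d * d + d * d), Φ.depth = T + 2 ∧
      Φ.weights ≤ 48 * d ^ 3 * (T + 1) ∧
      ∀ v, specNorm (fstMatr v) ≤ 1 → specNorm (sndMatr v) ≤ Z →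
        specNorm (fstMatr (Φ.realize v) - fstMatr v * fstMatr v) ≤ d ^ 3 * (2 * Z ^ 2) / 4 ^ T ∧
        specNorm (sndMatr (Φ.realize v) - (1 + fstMatr v) * sndMatr v)
          ≤ d ^ 3 * (2 * Z ^ 2) / 4 ^ T := by
  -- The index `(s, i, k, j)` stands for `P i k * P k j` if `s` is false and for `(1 + P) i k * S k
  -- j` if `s` is true; the bias supplies the identity matrix. Entries of `1 + P` are at most `2 ≤
  -- Z`, hence the assumption on `Z`.
  obtain ⟨Φ, h1, h2, h3⟩ := exists_productNet (n := d * d + d * d) (k := d * d + d * d)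
    (J := Bool × Fin d × Fin d × Fin d)
    (fun j => Fin.castAdd (d * d) (finProdFinEquiv (j.2.2.1, j.2.1)))
    (fun j => if j.1 then Fin.natAdd (d * d) (finProdFinEquiv (j.2.2.2, j.2.2.1))
      else Fin.castAdd (d * d) (finProdFinEquiv (j.2.2.2, j.2.2.1)))
    (fun j => if j.1 then (1 : Matrix (Fin d) (Fin d) ℝ) j.2.1 j.2.2.1 else 0)
    (fun j => if j.1 then Fin.natAdd (d * d) (finProdFinEquiv (j.2.2.2, j.2.1))
      else Fin.castAdd (d * d) (finProdFinEquiv (j.2.2.2, j.2.1)))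
    (K := 2 * Z) (by positivity) T
  refine ⟨Φ, h1, ?_, fun v hP hS => ?_⟩
  · refine h2.trans_eq ?_
    simp only [Fintype.card_prod, Fintype.card_bool, Fintype.card_fin]; ring
  have hone : ∀ i k, |(1 : Matrix (Fin d) (Fin d) ℝ) i k| ≤ 1 := fun i k =>
    (abs_apply_le_specNorm _ i k).trans specNorm_one_le
  have hPe : ∀ i k, |v (Fin.castAdd (d * d) (finProdFinEquiv (k, i)))| ≤ 1 := fun i k =>
    (abs_apply_le_specNorm (fstMatr v) i k).trans hP
  have hSe : ∀ i k, |v (Fin.natAdd (d * d) (finProdFinEquiv (k, i)))| ≤ Z := fun i k =>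
    (abs_apply_le_specNorm (sndMatr v) i k).trans hS
  have h4 := h3 v
    (by
      rintro ⟨s, i, k, j⟩
      have a1 := abs_add_le (v (Fin.castAdd (d * d) (finProdFinEquiv (k, i))))
        ((1 : Matrix (Fin d) (Fin d) ℝ) i k)
      have a2 := hone i k
      have a3 := hPe i k
      cases s
      · simp only [Bool.false_eq_true, if_false, add_zero]; linarith
      · simp only [if_true]; linarith)
    (by
      rintro ⟨s, i, k, j⟩
      have a2 := hSe k j
      have a3 := hPe k j
      cases s
      · simp only [Bool.false_eq_true, if_false]; linarith
      · simp only [if_true]; linarith)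
  have hη : (d : ℝ) ^ 3 * (2 * Z ^ 2) / 4 ^ T
      = d * (d * (d * ((2 * Z) ^ 2 / (2 * 4 ^ T)))) := by
    field_simp
  have hinj : ∀ (s : Bool) (i j : Fin d), Function.Injective
      fun k : Fin d => ((s, i, k, j) : Bool × Fin d × Fin d × Fin d) := by
    intro s i j a b h
    simpa using h
  rw [hη]
  constructor
  · refine specNorm_le_of_abs_le (by positivity) fun i j => ?_
    have h5 := h4 (Fin.castAdd _ (finProdFinEquiv (j, i)))
    have hfil : (Finset.univ.filter fun a : Bool × Fin d × Fin d × Fin d =>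
        (if a.1 then Fin.natAdd (d * d) (finProdFinEquiv (a.2.2.2, a.2.1))
          else Fin.castAdd (d * d) (finProdFinEquiv (a.2.2.2, a.2.1)))
          = Fin.castAdd _ (finProdFinEquiv (j, i)))
        = Finset.univ.map ⟨fun k : Fin d => (false, i, k, j), hinj false i j⟩ := by
      ext ⟨s, a, k, b⟩
      cases s
      · simp only [Finset.mem_filter, Finset.mem_univ, true_and, Bool.false_eq_true, if_false,
          Fin.castAdd_inj, EmbeddingLike.apply_eq_iff_eq, Prod.mk.injEq, Finset.mem_map,
          Function.Embedding.coeFn_mk]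
        constructor
        · rintro ⟨rfl, rfl⟩; exact ⟨k, rfl, rfl, rfl⟩
        · rintro ⟨_, h1, _, h2⟩; exact ⟨h2.symm, h1.symm⟩
      · have : ∀ x y : Fin (d * d), Fin.natAdd (d * d) x ≠ Fin.castAdd (d * d) y := by
          intro x y h
          have := congrArg Fin.val h
          simp only [Fin.val_natAdd, Fin.val_castAdd] at this
          omega
        simp only [Finset.mem_filter, Finset.mem_univ, true_and, if_true, this, Finset.mem_map,
          Function.Embedding.coeFn_mk, Prod.mk.injEq, Bool.false_eq_true, false_and, exists_false]
    rw [hfil, Finset.sum_map, Finset.card_map, Finset.card_univ, Fintype.card_fin] at h5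
    simp only [Function.Embedding.coeFn_mk, Bool.false_eq_true, if_false, add_zero] at h5
    exact h5
  · refine specNorm_le_of_abs_le (by positivity) fun i j => ?_
    have h5 := h4 (Fin.natAdd _ (finProdFinEquiv (j, i)))
    have hfil : (Finset.univ.filter fun a : Bool × Fin d × Fin d × Fin d =>
        (if a.1 then Fin.natAdd (d * d) (finProdFinEquiv (a.2.2.2, a.2.1))
          else Fin.castAdd (d * d) (finProdFinEquiv (a.2.2.2, a.2.1)))
          = Fin.natAdd _ (finProdFinEquiv (j, i)))
        = Finset.univ.map ⟨fun k : Fin d => (true, i, k, j), hinj true i j⟩ := by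
      ext ⟨s, a, k, b⟩
      cases s
      · have : ∀ x y : Fin (d * d), Fin.castAdd (d * d) x ≠ Fin.natAdd (d * d) y := by
          intro x y h
          have := congrArg Fin.val h
          simp only [Fin.val_natAdd, Fin.val_castAdd] at this
          omega
        simp only [Finset.mem_filter, Finset.mem_univ, true_and, Bool.false_eq_true, if_false,
          this, Finset.mem_map, Function.Embedding.coeFn_mk, Prod.mk.injEq, reduceCtorEq,
          false_and, exists_false]
      · simp only [Finset.mem_filter, Finset.mem_univ, true_and, if_true,
          Fin.natAdd_inj, EmbeddingLike.apply_eq_iff_eq, Prod.mk.injEq, Finset.mem_map,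
          Function.Embedding.coeFn_mk]
        constructor
        · rintro ⟨rfl, rfl⟩; exact ⟨k, rfl, rfl, rfl⟩
        · rintro ⟨_, h1, _, h2⟩; exact ⟨h2.symm, h1.symm⟩
    rw [hfil, Finset.sum_map, Finset.card_map, Finset.card_univ, Fintype.card_fin] at h5
    simp only [Function.Embedding.coeFn_mk, if_true] at h5
    rw [add_comm 1 (fstMatr v)]
    exact h5

/-! ### The Neumann series -/

/-- Perturbed accelerated Neumann series `(P, S) ↦ (P ^ 2, (1 + P) S)`, started at `(A, 1)`. -/
theorem neumann_bounds {d : ℕ} {A : Matrix (Fin d) (Fin d) ℝ} {r η Z : ℝ} {m : ℕ}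
    (P S : ℕ → Matrix (Fin d) (Fin d) ℝ) (hA : specNorm A ≤ r) (hr0 : 0 ≤ r) (hr1 : r < 1)
    (hη : 0 ≤ η) (hη1 : 4 ^ m * η ≤ 1 - r) (hη2 : 3 * (4 ^ m * η) ≤ 1) (hZ : 3 / (1 - r) ≤ Z)
    (hP0 : P 0 = A) (hS0 : S 0 = 1)
    (hstep : ∀ k, specNorm (P k) ≤ 1 → specNorm (S k) ≤ Z →
      specNorm (P (k + 1) - P k * P k) ≤ η ∧ specNorm (S (k + 1) - (1 + P k) * S k) ≤ η)
    {k : ℕ} (hk : k ≤ m) :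
    specNorm (P k) ≤ r ^ 2 ^ k + 4 ^ k * η ∧
      specNorm (S k * (1 - A) - (1 - P k)) ≤ 3 * (4 ^ k * η) := by
  obtain ⟨hu, hinv⟩ := isUnit_one_sub hA hr1
  have hu' := (Matrix.isUnit_iff_isUnit_det _).1 hu
  have h1A : specNorm (1 - A) ≤ 2 :=
    (specNorm_sub_le _ _).trans (by linarith [specNorm_one_le (n := d)])
  induction k with
  | zero =>
    constructor
    · rw [hP0]; simp; linarith
    · rw [hP0, hS0, one_mul, sub_self]
      have : specNorm (0 : Matrix (Fin d) (Fin d) ℝ) = 0 := by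
        simpa using specNorm_smul 0 (0 : Matrix (Fin d) (Fin d) ℝ)
      rw [this]; positivity
  | succ k ih =>
    obtain ⟨ihP, ihS⟩ := ih (by omega)
    have he : 4 ^ k * η ≤ 4 ^ m * η := by gcongr <;> [norm_num; omega]
    have hηk : η ≤ 4 ^ k * η := le_mul_of_one_le_left hη (one_le_pow₀ (by norm_num))
    have hrk : r ^ 2 ^ k ≤ r := pow_le_of_le_one hr0 hr1.le (by positivity)
    have hP1 : specNorm (P k) ≤ 1 := by linarith
    -- `S k * (1 - A)` differs by at most 1 from `1 - P k`, which has norm at most 2, so `S k` is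
    -- bounded by `3 / (1 - r)` uniformly in `k`. Thus one product network serves all steps.
    have hSZ : specNorm (S k) ≤ Z := by
      have e : S k = ((S k * (1 - A) - (1 - P k)) + (1 - P k)) * (1 - A)⁻¹ := by
        rw [sub_add_cancel, Matrix.mul_assoc, Matrix.mul_nonsing_inv _ hu', Matrix.mul_one]
      rw [e]
      refine (specNorm_mul_le _ _).trans (le_trans ?_ hZ)
      have b1 : specNorm ((S k * (1 - A) - (1 - P k)) + (1 - P k)) ≤ 3 := by
        have a1 := specNorm_add_le (S k * (1 - A) - (1 - P k)) (1 - P k)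
        have a2 := specNorm_sub_le 1 (P k)
        have a3 := specNorm_one_le (n := d)
        linarith
      rw [div_eq_mul_inv]
      exact mul_le_mul b1 hinv (specNorm_nonneg _) (by norm_num)
    obtain ⟨sP, sS⟩ := hstep k hP1 hSZ
    constructor
    · have a1 := specNorm_add_le (P (k + 1) - P k * P k) (P k * P k)
      rw [sub_add_cancel] at a1
      have a2 := specNorm_mul_le (P k) (P k)
      have a3 : specNorm (P k) * specNorm (P k)
          ≤ (r ^ 2 ^ k + 4 ^ k * η) * (r ^ 2 ^ k + 4 ^ k * η) :=
        mul_le_mul ihP ihP (specNorm_nonneg _) (by positivity)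
      have a4 : r ^ 2 ^ (k + 1) = r ^ 2 ^ k * r ^ 2 ^ k := by rw [pow_succ, mul_two, pow_add]
      have a5 : 0 ≤ r ^ 2 ^ k := by positivity
      -- The cross terms of the square contribute at most `3 * 4^k η`; the new product error adds `η
      -- ≤ 4^k η`.
      have a6 : (2 * r ^ 2 ^ k + 4 ^ k * η) * (4 ^ k * η) ≤ 3 * (4 ^ k * η) := by
        gcongr; linarith
      rw [a4, pow_succ]
      linarith
    -- Exact steps satisfy `S (1 - A) = 1 - P`. The three terms of this identity are at most `2η`,
    -- `6 * 4^k η` and `η`, together below `3 * 4^(k+1) η`.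
    · have e : S (k + 1) * (1 - A) - (1 - P (k + 1))
          = (S (k + 1) - (1 + P k) * S k) * (1 - A)
            + (1 + P k) * (S k * (1 - A) - (1 - P k)) + (P (k + 1) - P k * P k) := by
        noncomm_ring
      rw [e]
      have a1 := specNorm_add_le ((S (k + 1) - (1 + P k) * S k) * (1 - A)
            + (1 + P k) * (S k * (1 - A) - (1 - P k))) (P (k + 1) - P k * P k)
      have a2 := specNorm_add_le ((S (k + 1) - (1 + P k) * S k) * (1 - A))
        ((1 + P k) * (S k * (1 - A) - (1 - P k)))
      have a3 : specNorm ((S (k + 1) - (1 + P k) * S k) * (1 - A)) ≤ η * 2 :=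
        (specNorm_mul_le _ _).trans (mul_le_mul sS h1A (specNorm_nonneg _) hη)
      have a4 : specNorm (1 + P k) ≤ 2 :=
        (specNorm_add_le _ _).trans (by linarith [specNorm_one_le (n := d)])
      have a5 : specNorm ((1 + P k) * (S k * (1 - A) - (1 - P k))) ≤ 2 * (3 * (4 ^ k * η)) :=
        (specNorm_mul_le _ _).trans (mul_le_mul a4 ihS (specNorm_nonneg _) (by norm_num))
      rw [pow_succ]
      linarith

/-- Multiplying the residual by the bounded inverse: `S - (1 - A)⁻¹` is `((S (1 - A) - (1 - P)) - P)
(1 - A)⁻¹`. -/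
lemma neumann_error {d : ℕ} {A P S : Matrix (Fin d) (Fin d) ℝ} {r a e : ℝ}
    (hA : specNorm A ≤ r) (hr1 : r < 1) (hP : specNorm P ≤ a)
    (hS : specNorm (S * (1 - A) - (1 - P)) ≤ e) :
    specNorm ((1 - A)⁻¹ - S) ≤ (a + e) / (1 - r) := by
  obtain ⟨hu, hinv⟩ := isUnit_one_sub hA hr1
  have hu' := (Matrix.isUnit_iff_isUnit_det _).1 hu
  have h : S - (1 - A)⁻¹ = ((S * (1 - A) - (1 - P)) - P) * (1 - A)⁻¹ := by
    have h1 : (S * (1 - A) - (1 - P)) - P = S * (1 - A) - 1 := by abel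
    rw [h1, Matrix.sub_mul, Matrix.mul_assoc, Matrix.mul_nonsing_inv _ hu', Matrix.mul_one,
      Matrix.one_mul]
  rw [specNorm_sub_comm, h, div_eq_mul_inv]
  refine (specNorm_mul_le _ _).trans (mul_le_mul ?_ hinv (specNorm_nonneg _) ?_)
  · exact (specNorm_sub_le _ _).trans (by linarith)
  · linarith [specNorm_nonneg P, specNorm_nonneg (S * (1 - A) - (1 - P))]

namespace NN

/-- The network `Φ₁ ⊙ ⋯ ⊙ Φ₁ ⊙ Φ₀` with `k` factors `Φ₁`. -/
noncomputable def iterConcat {m n : ℕ} (Φ₁ : NN n n) (Φ₀ : NN m n) : ℕ → NN m n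
  | 0 => Φ₀
  | k + 1 => sparseConcat Φ₁ (iterConcat Φ₁ Φ₀ k)

lemma realize_iterConcat_succ {m n : ℕ} (Φ₁ : NN n n) (Φ₀ : NN m n) (k : ℕ) (x : Fin m → ℝ) :
    (iterConcat Φ₁ Φ₀ (k + 1)).realize x = Φ₁.realize ((iterConcat Φ₁ Φ₀ k).realize x) :=
  realize_sparseConcat _ _ _

lemma depth_iterConcat {m n : ℕ} (Φ₁ : NN n n) (Φ₀ : NN m n) (k : ℕ) :
    (iterConcat Φ₁ Φ₀ k).depth = k * Φ₁.depth + Φ₀.depth := by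
  induction k with
  | zero => simp [iterConcat]
  | succ k ih => rw [iterConcat, depth_sparseConcat, ih]; ring

/-- Both bounds are proved together: the last layer never exceeds `2 B`, so each new factor adds at
most `4 B` and the growth is linear in `k`, not exponential. -/
lemma weights_iterConcat_le {m n B : ℕ} (Φ₁ : NN n n) (Φ₀ : NN m n) (h₁ : Φ₁.weights ≤ B)
    (h₀ : Φ₀.weights ≤ B) (k : ℕ) :
    (iterConcat Φ₁ Φ₀ k).weights ≤ (4 * k + 1) * B ∧
      (iterConcat Φ₁ Φ₀ k).lastWeights ≤ 2 * B := by
  have a1 := firstWeights_le Φ₁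
  have a2 := lastWeights_le Φ₁
  induction k with
  | zero => have a3 := lastWeights_le Φ₀; simp only [iterConcat]; omega
  | succ k ih =>
    have b1 := weights_sparseConcat_le Φ₁ (iterConcat Φ₁ Φ₀ k)
    have b2 := lastWeights_sparseConcat_le Φ₁ (iterConcat Φ₁ Φ₀ k)
    rw [iterConcat]
    constructor
    · have : (4 * (k + 1) + 1) * B = (4 * k + 1) * B + 4 * B := by ring
      omega
    · omega

end NN

/-- A network that inverts `1 - A`. -/
theorem exists_invNet {d : ℕ} (hd : 1 ≤ d) {r η Z : ℝ} (hr0 : 0 ≤ r) (hr1 : r < 1) (m T : ℕ)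
    (hZ : 2 ≤ Z) (hZ' : 3 / (1 - r) ≤ Z) (hη : η = d ^ 3 * (2 * Z ^ 2) / 4 ^ T)
    (hη1 : 4 ^ m * η ≤ 1 - r) (hη2 : 3 * (4 ^ m * η) ≤ 1) :
    ∃ Φ : NN (d * d) (d * d), Φ.depth = m * (T + 2) + 2 ∧
      Φ.weights ≤ (4 * m + 4) * (48 * d ^ 3 * (T + 1)) ∧
      ApproxInv Φ r ((r ^ 2 ^ m + 4 * (4 ^ m * η)) / (1 - r)) := by
  obtain ⟨G, hG1, hG2, hG3⟩ := exists_neumannStepNet d hZ T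
  -- `Φ₀` produces the starting pair `(A, 1)`, and `E` below reads off the second component of the
  -- final pair.
  let Φ₀ : NN (d * d) (d * d + d * d) :=
    NN.last (stackRows (1 : Matrix (Fin (d * d)) (Fin (d * d)) ℝ) 0) (Fin.append 0 (vec 1))
  have hB : 2 * (d * d) ≤ 48 * d ^ 3 * (T + 1) := by
    have : d * d * 1 ≤ d ^ 3 * (T + 1) := by
      rw [pow_succ, sq]
      exact (Nat.mul_le_mul_left _ hd).trans (Nat.le_mul_of_pos_right _ (Nat.succ_pos _))
    linarith
  have hΦ₀ : Φ₀.weights ≤ 48 * d ^ 3 * (T + 1) := by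
    have := nnzVec_le (vec (1 : Matrix (Fin d) (Fin d) ℝ))
    simp only [Φ₀, NN.weights, nnzMat_stackRows, nnzVec_append, nnzMat_one, nnzVec_zero]
    have h0 : nnzMat (0 : Matrix (Fin (d * d)) (Fin (d * d)) ℝ) = 0 := by simp [nnzMat]
    omega
  obtain ⟨w1, w2⟩ := NN.weights_iterConcat_le G Φ₀ hG2 hΦ₀ m
  let E : NN (d * d + d * d) (d * d) :=
    NN.last (stackCols 0 (1 : Matrix (Fin (d * d)) (Fin (d * d)) ℝ)) 0
  have hE : E.weights = d * d := by
    have h0 : nnzMat (0 : Matrix (Fin (d * d)) (Fin (d * d)) ℝ) = 0 := by simp [nnzMat]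
    simp only [E, NN.weights, nnzMat_stackCols, nnzMat_one, nnzVec_zero, h0]; omega
  refine ⟨NN.sparseConcat E (NN.iterConcat G Φ₀ m), ?_, ?_, fun A hA => ?_⟩
  · rw [NN.depth_sparseConcat, NN.depth_iterConcat, hG1]
    simp only [E, Φ₀, NN.depth]; ring
  · have b1 := NN.weights_sparseConcat_le E (NN.iterConcat G Φ₀ m)
    have b2 := NN.firstWeights_le E
    have : (4 * m + 4) * (48 * d ^ 3 * (T + 1)) = (4 * m + 1) * (48 * d ^ 3 * (T + 1))
      + 3 * (48 * d ^ 3 * (T + 1)) := by ring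
    omega
  · let P : ℕ → Matrix (Fin d) (Fin d) ℝ := fun k =>
      fstMatr ((NN.iterConcat G Φ₀ k).realize (vec A))
    let S : ℕ → Matrix (Fin d) (Fin d) ℝ := fun k =>
      sndMatr ((NN.iterConcat G Φ₀ k).realize (vec A))
    have h0 : (NN.iterConcat G Φ₀ 0).realize (vec A) = Fin.append (vec A) (vec 1) := by
      simp only [NN.iterConcat, Φ₀, NN.realize, stackRows_mulVec, append_add_append]
      simp
    have hP0 : P 0 = A := by
      simp only [P, h0, fstMatr, Fin.append_left]; exact matr_vec A
    have hS0 : S 0 = 1 := by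
      simp only [S, h0, sndMatr, Fin.append_right]; exact matr_vec 1
    have hη0 : 0 ≤ η := by rw [hη]; positivity
    obtain ⟨hP, hS⟩ := neumann_bounds P S hA hr0 hr1 hη0 hη1 hη2 hZ' hP0 hS0
      (fun k h1 h2 => by
        simp only [P, S, NN.realize_iterConcat_succ]
        rw [hη]
        exact hG3 _ h1 h2) le_rfl
    have hreal : matr ((NN.sparseConcat E (NN.iterConcat G Φ₀ m)).realize (vec A)) = S m := by
      rw [NN.realize_sparseConcat]
      simp only [S, sndMatr, E, NN.realize, add_zero]
      congr 1
      set v := (NN.iterConcat G Φ₀ m).realize (vec A)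
      have hv : v = Fin.append (fun c => v (Fin.castAdd _ c)) (fun c => v (Fin.natAdd _ c)) := by
        ext i
        refine Fin.addCases (fun i => ?_) (fun i => ?_) i <;> simp [-Fin.natAdd_eq_addNat]
      rw [hv, stackCols_mulVec]
      simp [-Fin.natAdd_eq_addNat]
    rw [hreal]
    refine (neumann_error hA hr1 hP hS).trans_eq ?_
    ring

/-! ### Complexity of the networks -/

lemma exists_le_two_pow {x : ℝ} (hx : 1 ≤ x) :
    ∃ T : ℕ, x ≤ 2 ^ T ∧ (T : ℝ) ≤ Real.logb 2 x + 1 := by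
  have h0 : 0 ≤ Real.logb 2 x := Real.logb_nonneg (by norm_num) hx
  refine ⟨⌈Real.logb 2 x⌉₊, ?_, (Nat.ceil_lt_add_one h0).le⟩
  rw [← Real.rpow_natCast, ← Real.logb_le_iff_le_rpow (by norm_num) (by linarith)]
  exact Nat.le_ceil _

lemma le_four_pow {x y : ℝ} {T : ℕ} (hx : 0 ≤ x) (h : x ≤ 2 ^ T) (hy : y ≤ x ^ 2) :
    y ≤ 4 ^ T := by
  refine hy.trans ?_
  have : (4 : ℝ) ^ T = (2 ^ T) ^ 2 := by rw [← pow_mul, mul_comm T, pow_mul]; norm_num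
  rw [this]
  gcongr

/-- Admissible `ε` are below `1/8`. Then `ℓ > 3` and `log₂ ℓ > 1`, so that additive constants can be
absorbed into the logarithmic terms. -/
lemma three_lt_logb {ε : ℝ} (h0 : 0 < ε) (h1 : ε < 1 / 8) : 3 < Real.logb 2 (1 / ε) := by
  rw [Real.lt_logb_iff_rpow_lt (by norm_num) (by positivity)]
  have : (2 : ℝ) ^ (3 : ℝ) = 8 := by norm_num
  rw [this, lt_div_iff₀ h0]
  linarith

lemma one_lt_logb_logb {ε : ℝ} (h0 : 0 < ε) (h1 : ε < 1 / 8) :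
    1 < Real.logb 2 (Real.logb 2 (1 / ε)) := by
  have h := three_lt_logb h0 h1
  rw [Real.lt_logb_iff_rpow_lt (by norm_num) (by linarith), Real.rpow_one]
  linarith

lemma logb_natCast_nonneg (d : ℕ) (hd : 1 ≤ d) : 0 ≤ Real.logb 2 d :=
  Real.logb_nonneg (by norm_num) (by exact_mod_cast hd)

/-- Matrix-vector multiplication with logarithmic depth. -/
theorem exists_multNet_complexity {Z : ℝ} (hZ : 0 < Z) :
    ∃ C > (0 : ℝ), ∀ (d : ℕ) (ε : ℝ), 1 ≤ d → 0 < ε → ε < 1 / 8 →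
      ∃ Φ : NN (d * d + d) d, ApproxMult Φ Z (ε / 12) ∧
        (Φ.depth : ℝ) ≤ C * (Real.logb 2 (1 / ε) + Real.logb 2 d) ∧
        (Φ.weights : ℝ) ≤ C * d ^ 2 * (Real.logb 2 (1 / ε) + Real.logb 2 d) := by
  set X : ℝ := 1 + 24 * Z ^ 2 with hX
  have hX1 : 1 ≤ X := by rw [hX]; nlinarith [sq_nonneg Z]
  have hlX : 0 ≤ Real.logb 2 X := Real.logb_nonneg (by norm_num) hX1
  refine ⟨24 * (Real.logb 2 X + 4), by positivity, fun d ε hd h0 h1 => ?_⟩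
  have hd1 : (1 : ℝ) ≤ d := by exact_mod_cast hd
  have hl := three_lt_logb h0 h1
  have hld := logb_natCast_nonneg d hd
  have hε1 : 1 ≤ 1 / ε := by rw [le_div_iff₀ h0]; linarith
  obtain ⟨T, hT, hT'⟩ := exists_le_two_pow (x := d * X * (1 / ε))
    (one_le_mul_of_one_le_of_one_le (one_le_mul_of_one_le_of_one_le hd1 hX1) hε1)
  rw [Real.logb_mul (by positivity) (by positivity), Real.logb_mul (by positivity) (by positivity)]
    at hT'
  obtain ⟨Φ, g1, g2, g3⟩ := exists_multNet d hZ T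
  have hTb : (T : ℝ) + 2 ≤ (Real.logb 2 X + 4) * (Real.logb 2 (1 / ε) + Real.logb 2 d) := by
    nlinarith
  refine ⟨Φ, fun A w hA hw => (g3 A w hA hw).trans ?_, ?_, ?_⟩
  -- The square of `d X / ε ≤ 2^T` is more than needed; the slack only affects constants.
  · have h4 : (d : ℝ) ^ 2 * X * (1 / ε) ≤ 4 ^ T := by
      refine le_four_pow (by positivity) hT ?_
      calc (d : ℝ) ^ 2 * X * (1 / ε) ≤ d ^ 2 * (X * X) * (1 / ε * (1 / ε)) := by
            gcongr
            · exact le_mul_of_one_le_left (by linarith) hX1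
            · exact le_mul_of_one_le_left (by positivity) hε1
        _ = _ := by ring
    rw [div_le_iff₀ (by positivity)]
    calc (d : ℝ) ^ 2 * (2 * Z ^ 2) ≤ d ^ 2 * (X / 12) := by gcongr; rw [hX]; linarith
      _ = ε / 12 * (d ^ 2 * X * (1 / ε)) := by field_simp
      _ ≤ _ := by gcongr
  · rw [g1]; push_cast
    nlinarith
  · have : (Φ.weights : ℝ) ≤ 24 * d ^ 2 * (T + 1) := by exact_mod_cast g2
    refine this.trans ?_
    calc (24 : ℝ) * d ^ 2 * (T + 1)
        ≤ 24 * d ^ 2 * ((Real.logb 2 X + 4) * (Real.logb 2 (1 / ε) + Real.logb 2 d)) := by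
          gcongr; linarith
      _ = _ := by ring

/-- From `r ≤ exp (-(1 - r))` one gets `r^N ≤ exp (-(1 - r) N)`. As `log 2 ≤ 1 ≤ l`, the assumed
size of `N` pays for both `log (1/ε)` and `|log c|`. -/
lemma pow_le_mul_of_le {r ε c l : ℝ} {N : ℕ} (hr0 : 0 ≤ r) (hr1 : r < 1) (hε : 0 < ε)
    (hc : 0 < c) (hl : l = Real.logb 2 (1 / ε)) (hl1 : 1 ≤ l)
    (hN : (1 + |Real.log c|) / (1 - r) * l ≤ N) : r ^ N ≤ c * ε := by
  have h1 : r ≤ Real.exp (-(1 - r)) := by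
    have := Real.add_one_le_exp (-(1 - r)); linarith
  have h2 : r ^ N ≤ Real.exp (-(1 - r) * N) := by
    rw [mul_comm, Real.exp_nat_mul]; gcongr
  refine h2.trans ?_
  rw [← Real.le_log_iff_exp_le (by positivity), Real.log_mul hc.ne' hε.ne']
  have h3 : Real.log ε = -(l * Real.log 2) := by
    rw [hl, Real.logb, div_mul_cancel₀ _ (Real.log_pos (by norm_num)).ne', one_div, Real.log_inv,
      neg_neg]
  have h4 : Real.log 2 ≤ 1 := by
    have := Real.log_two_lt_d9; linarith
  have h5 : (1 + |Real.log c|) * l ≤ (1 - r) * N := by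
    rw [div_mul_eq_mul_div, div_le_iff₀ (by linarith)] at hN
    linarith
  have h6 := neg_abs_le (Real.log c)
  have h7 := abs_nonneg (Real.log c)
  rw [h3]
  nlinarith

/-- The number of steps and the accuracy that the accelerated Neumann series needs. -/
lemma exists_neumann_parameters {r c : ℝ} (hr0 : 0 ≤ r) (hr1 : r < 1) (hc : 0 < c) :
    ∃ Z a b : ℝ, 2 ≤ Z ∧ 3 / (1 - r) ≤ Z ∧ 0 < a ∧ 0 < b ∧
      ∀ (d : ℕ) (ε : ℝ), 1 ≤ d → 0 < ε → ε < 1 / 8 → ∃ m T : ℕ,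
        4 ^ m * (d ^ 3 * (2 * Z ^ 2) / 4 ^ T) ≤ 1 - r ∧
        3 * (4 ^ m * (d ^ 3 * (2 * Z ^ 2) / 4 ^ T)) ≤ 1 ∧
        (r ^ 2 ^ m + 4 * (4 ^ m * (d ^ 3 * (2 * Z ^ 2) / 4 ^ T))) / (1 - r) ≤ c * ε ∧
        (m : ℝ) ≤ a * Real.logb 2 (Real.logb 2 (1 / ε)) ∧
        (T : ℝ) + 2 ≤ b * (Real.logb 2 (1 / ε) + Real.logb 2 (Real.logb 2 (1 / ε))
          + Real.logb 2 d) := by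
  have hδ : 0 < 1 - r := by linarith
  set Z : ℝ := 3 / (1 - r) with hZ
  have hZ2 : 2 ≤ Z := by rw [hZ, le_div_iff₀ hδ]; linarith
  -- Half of the error budget goes to the truncation `r^(2^m)`, the other half to the products,
  -- whence `c₂ / 4` in `c₁`. The remaining entries of the minimum give the first two required
  -- inequalities. `Y` and `X` turn these demands into lower bounds for `2^m` and `2^T`.
  set c₂ : ℝ := (1 - r) * c / 2 with hc₂
  have hc₂0 : 0 < c₂ := by positivity
  set c₁ : ℝ := min (c₂ / 4) (min (1 - r) (1 / 3)) with hc₁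
  have hc₁0 : 0 < c₁ := by rw [hc₁]; positivity
  set Y : ℝ := (1 + |Real.log c₂|) / (1 - r) with hY
  have hY1 : 1 ≤ Y := by
    rw [hY, le_div_iff₀ hδ]; linarith [abs_nonneg (Real.log c₂)]
  set X : ℝ := 1 + 2 * Z ^ 2 / c₁ with hX
  have hX1 : 1 ≤ X := by rw [hX]; linarith [(by positivity : 0 ≤ 2 * Z ^ 2 / c₁)]
  have hlX : 0 ≤ Real.logb 2 X := Real.logb_nonneg (by norm_num) hX1
  have hlY : 0 ≤ Real.logb 2 Y := Real.logb_nonneg (by norm_num) hY1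
  set a : ℝ := Real.logb 2 Y + 2 with ha
  set b : ℝ := a + Real.logb 2 X + 4 with hb
  have ha0 : 0 < a := by positivity
  have hb0 : 0 < b := by positivity
  refine ⟨Z, a, b, hZ2, le_rfl, ha0, hb0, fun d ε hd h0 h1 => ?_⟩
  have hd1 : (1 : ℝ) ≤ d := by exact_mod_cast hd
  have hl := three_lt_logb h0 h1
  have hll := one_lt_logb_logb h0 h1
  have hld := logb_natCast_nonneg d hd
  have hε1 : 1 ≤ 1 / ε := by rw [le_div_iff₀ h0]; linarith
  set l := Real.logb 2 (1 / ε) with hl_def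
  set ll := Real.logb 2 l with hll_def
  set ld := Real.logb 2 (d : ℝ) with hld_def
  -- The error decays like `r^(2^m)`, so `2^m` of order `ℓ` suffices and `m` is of order `log₂ ℓ`.
  obtain ⟨m, hm, hm'⟩ := exists_le_two_pow (x := Y * l)
    (one_le_mul_of_one_le_of_one_le hY1 (by linarith))
  rw [Real.logb_mul (by positivity) (by positivity), ← hll_def] at hm'
  -- The factor `2^m` (squared, `4^m`) compensates the error growth over the `m` steps; it
  -- contributes the `log₂ ℓ` term to `T`.
  obtain ⟨T, hT, hT'⟩ := exists_le_two_pow (x := d ^ 2 * 2 ^ m * X * (1 / ε))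
    (one_le_mul_of_one_le_of_one_le (one_le_mul_of_one_le_of_one_le
      (one_le_mul_of_one_le_of_one_le (one_le_pow₀ hd1) (one_le_pow₀ (by norm_num))) hX1) hε1)
  rw [Real.logb_mul (by positivity) (by positivity), Real.logb_mul (by positivity) (by positivity),
    Real.logb_mul (by positivity) (by positivity), Real.logb_pow, Real.logb_pow,
    Real.logb_self_eq_one (by norm_num), ← hl_def, ← hld_def] at hT'
  push_cast at hT'
  set η : ℝ := d ^ 3 * (2 * Z ^ 2) / 4 ^ T with hη
  have hη0 : 0 ≤ η := by positivity
  have hηb : 4 ^ m * η ≤ c₁ * ε := by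
    have h4 : (d : ℝ) ^ 3 * 4 ^ m * X * (1 / ε) ≤ 4 ^ T := by
      refine le_four_pow (by positivity) hT ?_
      have e4 : (4 : ℝ) ^ m = 2 ^ m * 2 ^ m := by rw [← mul_pow]; norm_num
      calc (d : ℝ) ^ 3 * 4 ^ m * X * (1 / ε) ≤ d ^ 4 * 4 ^ m * (X * X) * (1 / ε * (1 / ε)) := by
            gcongr
            · norm_num
            · exact le_mul_of_one_le_left (by linarith) hX1
            · exact le_mul_of_one_le_left (by positivity) hε1
        _ = _ := by rw [e4]; ring
    rw [hη, ← mul_div_assoc, div_le_iff₀ (by positivity)]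
    have h5 : 2 * Z ^ 2 ≤ c₁ * X := by
      rw [hX, mul_add, mul_div_cancel₀ _ hc₁0.ne']; linarith
    calc (4 : ℝ) ^ m * (d ^ 3 * (2 * Z ^ 2)) ≤ 4 ^ m * (d ^ 3 * (c₁ * X)) := by gcongr
      _ = c₁ * ε * (d ^ 3 * 4 ^ m * X * (1 / ε)) := by field_simp
      _ ≤ _ := by gcongr
  have k1 : c₁ ≤ c₂ / 4 := min_le_left _ _
  have k2 : c₁ ≤ 1 - r := (min_le_right _ _).trans (min_le_left _ _)
  have k3 : c₁ ≤ 1 / 3 := (min_le_right _ _).trans (min_le_right _ _)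
  have hηc : 4 ^ m * η ≤ c₁ := hηb.trans (mul_le_of_le_one_right hc₁0.le (by linarith))
  have hrm : r ^ 2 ^ m ≤ c₂ * ε := by
    refine pow_le_mul_of_le hr0 hr1 h0 hc₂0 hl_def (by linarith) ?_
    push_cast
    exact hm
  have hma : (m : ℝ) ≤ a * ll := by nlinarith
  refine ⟨m, T, hηc.trans k2, by linarith, ?_, hma, ?_⟩
  · rw [div_le_iff₀ hδ]
    have : c₁ * ε ≤ c₂ / 4 * ε := mul_le_mul_of_nonneg_right k1 h0.le
    calc r ^ 2 ^ m + 4 * (4 ^ m * η) ≤ c₂ * ε + c₂ * ε := by linarith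
      _ = c * ε * (1 - r) := by rw [hc₂]; ring
  · have q1 : (m : ℝ) ≤ a * (l + ll + ld) := hma.trans (by gcongr; linarith)
    have q2 : Real.logb 2 X ≤ Real.logb 2 X * (l + ll + ld) :=
      le_mul_of_one_le_right hlX (by linarith)
    rw [hb]
    linarith

/-- Inversion with logarithmic depth. -/
theorem exists_invNet_complexity {r c : ℝ} (hr0 : 0 ≤ r) (hr1 : r < 1) (hc : 0 < c) :
    ∃ C > (0 : ℝ), ∀ (d : ℕ) (ε : ℝ), 1 ≤ d → 0 < ε → ε < 1 / 8 →
      ∃ Φ : NN (d * d) (d * d), ApproxInv Φ r (c * ε) ∧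
        (Φ.depth : ℝ) ≤ C * Real.logb 2 (Real.logb 2 (1 / ε)) *
          (Real.logb 2 (1 / ε) + Real.logb 2 (Real.logb 2 (1 / ε)) + Real.logb 2 d) ∧
        (Φ.weights : ℝ) ≤ C * d ^ 3 * Real.logb 2 (Real.logb 2 (1 / ε)) *
          (Real.logb 2 (1 / ε) + Real.logb 2 (Real.logb 2 (1 / ε)) + Real.logb 2 d) := by
  obtain ⟨Z, a, b, hZ2, hZ, ha0, hb0, h⟩ := exists_neumann_parameters hr0 hr1 hc
  refine ⟨192 * (a + 1) * b, by positivity, fun d ε hd h0 h1 => ?_⟩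
  obtain ⟨m, T, p1, p2, p3, hma, hTb⟩ := h d ε hd h0 h1
  have hl := three_lt_logb h0 h1
  have hll := one_lt_logb_logb h0 h1
  have hld := logb_natCast_nonneg d hd
  obtain ⟨Φ, g1, g2, g3⟩ := exists_invNet hd hr0 hr1 m T hZ2 hZ rfl p1 p2
  generalize Real.logb 2 (Real.logb 2 (1 / ε)) = ll at *
  generalize Real.logb 2 (1 / ε) = l at *
  generalize Real.logb 2 (d : ℝ) = ld at *
  have hQ : 0 < l + ll + ld := by linarith
  have hT0 : (0 : ℝ) ≤ T := by positivity
  refine ⟨Φ, fun A hA => (g3 A hA).trans p3, ?_, ?_⟩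
  · rw [g1]; push_cast
    have h2 : 2 ≤ ll * (b * (l + ll + ld)) :=
      le_trans (by linarith) (le_mul_of_one_le_left (by positivity) hll.le)
    calc (m : ℝ) * (T + 2) + 2 ≤ a * ll * (b * (l + ll + ld)) + ll * (b * (l + ll + ld)) := by
          gcongr
      _ = 1 * ((a + 1) * b * ll * (l + ll + ld)) := by ring
      _ ≤ 192 * ((a + 1) * b * ll * (l + ll + ld)) := by gcongr; norm_num
      _ = _ := by ring
  · have : (Φ.weights : ℝ) ≤ (4 * m + 4) * (48 * d ^ 3 * (T + 1)) := by exact_mod_cast g2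
    refine this.trans ?_
    calc ((4 : ℝ) * m + 4) * (48 * d ^ 3 * (T + 1))
        ≤ (4 * (a * ll) + 4 * ll) * (48 * d ^ 3 * (b * (l + ll + ld))) := by
          gcongr <;> linarith
      _ = _ := by ring

/-! ### Galerkin matrices -/

section Galerkin

variable {H : Type u} [NormedAddCommGroup H] [InnerProductSpace ℝ H] {n : ℕ}

lemma norm_sum_smul_of_orthonormal {ψ : Fin n → H} (h : Orthonormal ℝ ψ) (x : Fin n → ℝ) :
    ‖∑ i, x i • ψ i‖ = euclid x := by
  rw [← abs_of_nonneg (norm_nonneg _), ← abs_of_nonneg (euclid_nonneg x), ← sq_eq_sq_iff_abs_eq_abs,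
    ← real_inner_self_eq_norm_sq, h.inner_sum, euclid_sq]
  simp [sq]

lemma dotProduct_stiffness_mulVec (b : H →L[ℝ] H →L[ℝ] ℝ) (φ : Fin n → H) (x y : Fin n → ℝ) :
    x ⬝ᵥ (stiffness b φ *ᵥ y) = b (∑ j, y j • φ j) (∑ i, x i • φ i) := by
  simp only [map_sum, map_smul, sum_apply, smul_apply,
    smul_eq_mul, dotProduct, Matrix.mulVec, stiffness, Matrix.of_apply, Finset.mul_sum]
  exact Finset.sum_congr rfl fun i _ => Finset.sum_congr rfl fun j _ => by ring

/-- Testing `f` on its own representer `∑ f(ψᵢ) ψᵢ` gives `|x|² ≤ ‖f‖ |x|`. -/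
lemma euclid_load_le (f : H →L[ℝ] ℝ) {ψ : Fin n → H} (h : Orthonormal ℝ ψ) :
    euclid (load f ψ) ≤ ‖f‖ := by
  set x := load f ψ with hx
  have h1 : euclid x ^ 2 = f (∑ i, x i • ψ i) := by
    rw [euclid_sq, map_sum]
    refine Finset.sum_congr rfl fun i _ => ?_
    rw [map_smul, smul_eq_mul, sq]
    rfl
  have h2 : f (∑ i, x i • ψ i) ≤ ‖f‖ * euclid x := by
    rw [← norm_sum_smul_of_orthonormal h]
    exact (le_abs_self _).trans (f.le_opNorm _)
  rcases (euclid_nonneg x).eq_or_lt with h0 | h0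
  · rw [← h0]; exact norm_nonneg f
  · nlinarith

/-- A symmetric matrix whose quadratic form is bounded. -/
lemma specNorm_le_of_symm {A : Matrix (Fin n) (Fin n) ℝ} {c : ℝ} (hc : 0 ≤ c)
    (hs : ∀ x y, x ⬝ᵥ (A *ᵥ y) = y ⬝ᵥ (A *ᵥ x)) (h : ∀ x, |x ⬝ᵥ (A *ᵥ x)| ≤ c * euclid x ^ 2) :
    specNorm A ≤ c := by
  refine specNorm_le_of_forall hc fun y => ?_
  set w := A *ᵥ y with hw
  set s := euclid w with hs_def
  set t := euclid y with ht_def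
  have hs0 : 0 ≤ s := euclid_nonneg w
  have ht0 : 0 ≤ t := euclid_nonneg y
  -- Polarisation with rescaled vectors: subtracting the form at `t w - s y` from that at `t w + s
  -- y` leaves `4 s³ t`, while the parallelogram law bounds the difference by `4 c s² t²`.
  have h1 := (abs_le.1 (h (t • w + s • y))).2
  have h2 := (abs_le.1 (h (t • w - s • y))).1
  have hyw : y ⬝ᵥ (A *ᵥ w) = s ^ 2 := by rw [hs y w, ← hw, hs_def, euclid_sq_eq_dotProduct]
  have hwy : w ⬝ᵥ (A *ᵥ y) = s ^ 2 := by rw [← hw, hs_def, euclid_sq_eq_dotProduct]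
  have e1 : euclid w ^ 2 = w ⬝ᵥ w := euclid_sq_eq_dotProduct w
  have e2 : euclid y ^ 2 = y ⬝ᵥ y := euclid_sq_eq_dotProduct y
  have e3 := dotProduct_comm w y
  simp only [euclid_sq_eq_dotProduct, Matrix.mulVec_add, Matrix.mulVec_sub, Matrix.mulVec_smul,
    dotProduct_add, add_dotProduct, dotProduct_sub, sub_dotProduct, smul_dotProduct,
    dotProduct_smul, smul_eq_mul, hyw, hwy] at h1 h2
  rw [← e1, ← e2, ← hs_def, ← ht_def] at h1 h2
  have h3 : s ^ 3 * t ≤ c * (s ^ 2 * t ^ 2) := by nlinarith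
  rcases hs0.eq_or_lt with h0 | h0
  · rw [← h0]; positivity
  rcases ht0.eq_or_lt with h0' | h0'
  · have := euclid_mulVec_le A y
    rw [← hw, ← hs_def, ← ht_def, ← h0'] at this
    linarith
  · have h4 : s * (s ^ 2 * t) ≤ c * t * (s ^ 2 * t) := by linarith
    exact le_of_mul_le_mul_right h4 (by positivity)

section SquareRoot

open scoped MatrixOrder Matrix.Norms.L2Operator

/-- The square root of the Gram matrix is symmetric, so `|G^(1/2) v|² = vᵀ G v`, which is the
squared norm of the combination. -/
lemma gNorm_eq_norm (φ : Fin n → H) (v : Fin n → ℝ) : gNorm φ v = ‖∑ i, v i • φ i‖ := by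
  have hG : (0 : Matrix (Fin n) (Fin n) ℝ) ≤ Matrix.gram ℝ φ :=
    Matrix.nonneg_iff_posSemidef.2 (Matrix.posSemidef_gram ℝ φ)
  have hsq : CFC.sqrt (Matrix.gram ℝ φ) * CFC.sqrt (Matrix.gram ℝ φ) = Matrix.gram ℝ φ :=
    CFC.sqrt_mul_sqrt_self _ hG
  have hsa : (CFC.sqrt (Matrix.gram ℝ φ))ᵀ = CFC.sqrt (Matrix.gram ℝ φ) := by
    have h := (Matrix.nonneg_iff_posSemidef.1 (CFC.sqrt_nonneg (Matrix.gram ℝ φ))).isHermitian.eq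
    rwa [Matrix.conjTranspose_eq_transpose_of_trivial] at h
  rw [gNorm, ← abs_of_nonneg (norm_nonneg _), ← abs_of_nonneg (euclid_nonneg _),
    ← sq_eq_sq_iff_abs_eq_abs, euclid_sq_eq_dotProduct, Matrix.dotProduct_mulVec,
    Matrix.vecMul_mulVec, hsa, hsq, ← real_inner_self_eq_norm_sq]
  simp only [sum_inner, inner_sum, real_inner_smul_left, real_inner_smul_right, dotProduct,
    Matrix.vecMul, Matrix.gram_apply, Finset.sum_mul]
  refine Finset.sum_congr rfl fun i _ => Finset.sum_congr rfl fun j _ => ?_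
  ring

end SquareRoot

lemma gNorm_mulVec {D d : ℕ} (φ : Fin D → H) (V : Matrix (Fin D) (Fin d) ℝ)
    (h : Orthonormal ℝ (transformBasis φ V)) (x : Fin d → ℝ) : gNorm φ (V *ᵥ x) = euclid x := by
  rw [gNorm_eq_norm, ← norm_sum_smul_of_orthonormal h]
  congr 1
  simp only [transformBasis, Matrix.mulVec, dotProduct, Finset.sum_smul, Finset.smul_sum,
    smul_smul]
  rw [Finset.sum_comm]
  exact Finset.sum_congr rfl fun i _ => Finset.sum_congr rfl fun j _ => by rw [mul_comm]

end Galerkin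

/-! ### Constants -/

lemma alpha_pos (Ccont : ℝ) : 0 < alpha Ccont := by
  have : 0 < max 1 Ccont := lt_max_of_lt_left one_pos
  rw [alpha]; positivity

lemma alpha_le_half (Ccont : ℝ) : alpha Ccont ≤ 1 / 2 := by
  have h : 1 ≤ max 1 Ccont := le_max_left _ _
  rw [alpha, one_div]
  exact inv_anti₀ (by norm_num) (by nlinarith)

lemma alpha_mul_le_half (Ccont : ℝ) : alpha Ccont * Ccont ≤ 1 / 2 := by
  have h : 1 ≤ max 1 Ccont := le_max_left _ _
  have h' : Ccont ≤ max 1 Ccont := le_max_right _ _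
  rw [alpha, inv_mul_eq_div, div_le_iff₀ (by positivity)]
  nlinarith

/-! ### The reduced-basis system -/

namespace ReducedBasisProblem

variable {p D : ℕ} {H : Type u} [NormedAddCommGroup H] [InnerProductSpace ℝ H]
  {Ccoer Ccont Crhs : ℝ} (S : ReducedBasisProblem p D H Ccoer Ccont Crhs) {t : ℝ}
  {y : Fin p → ℝ}

lemma coercive (hy : y ∈ S.Y) (u : H) : Ccoer * ‖u‖ ^ 2 ≤ S.b y u u := by
  rcases eq_or_ne u 0 with rfl | hu
  · simp
  · have h := S.coer y hy u hu
    rwa [le_div_iff₀ (by positivity)] at h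

/-- Both bounds are tested on the first reduced basis vector; a nonzero vector is needed, and `1 ≤ d
t` provides it. -/
lemma coer_le_cont (ht : S.epsHat ≤ t) : Ccoer ≤ Ccont := by
  obtain ⟨y, hy⟩ := S.nonempty_Y
  have h1 := S.coercive hy (S.ψ t ⟨0, S.d_pos t ht⟩)
  have h2 := S.cont y hy (S.ψ t ⟨0, S.d_pos t ht⟩) (S.ψ t ⟨0, S.d_pos t ht⟩)
  have h3 : ‖S.ψ t ⟨0, S.d_pos t ht⟩‖ = 1 := (S.orthonormal t ht).1 _
  rw [h3] at h1 h2
  have := le_abs_self (S.b y (S.ψ t ⟨0, S.d_pos t ht⟩) (S.ψ t ⟨0, S.d_pos t ht⟩))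
  linarith

lemma dotProduct_Brb (x z : Fin (S.d t) → ℝ) :
    x ⬝ᵥ (S.Brb t y *ᵥ z) = S.b y (∑ j, z j • S.ψ t j) (∑ i, x i • S.ψ t i) :=
  dotProduct_stiffness_mulVec _ _ _ _

lemma coer_mul_euclid_le (ht : S.epsHat ≤ t) (hy : y ∈ S.Y) (x : Fin (S.d t) → ℝ) :
    Ccoer * euclid x ≤ euclid (S.Brb t y *ᵥ x) := by
  have h1 := S.coercive hy (∑ j, x j • S.ψ t j)
  have e : ‖∑ j, x j • S.ψ t j‖ = euclid x := norm_sum_smul_of_orthonormal (S.orthonormal t ht) x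
  rw [← S.dotProduct_Brb, e] at h1
  have h2 := (le_abs_self _).trans (abs_dotProduct_le x (S.Brb t y *ᵥ x))
  rcases (euclid_nonneg x).eq_or_lt with h0 | h0
  · rw [← h0, mul_zero]; exact euclid_nonneg _
  · nlinarith

/-- The quadratic form of `α B^rb` lies between `α Ccoer |x|²` and `|x|² / 2`, so that of `1 - α
B^rb` is nonnegative and at most `(1 - α Ccoer) |x|²`. Symmetry turns this into a norm bound. -/
lemma specNorm_one_sub_le (ht : S.epsHat ≤ t) (hy : y ∈ S.Y) :
    specNorm (1 - alpha Ccont • S.Brb t y) ≤ 1 - alpha Ccont * Ccoer := by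
  have hα := alpha_pos Ccont
  have hαc := alpha_mul_le_half Ccont
  have hcc : alpha Ccont * Ccoer ≤ alpha Ccont * Ccont :=
    mul_le_mul_of_nonneg_left (S.coer_le_cont ht) hα.le
  have key : ∀ x z, x ⬝ᵥ ((1 - alpha Ccont • S.Brb t y) *ᵥ z)
      = x ⬝ᵥ z - alpha Ccont * (x ⬝ᵥ (S.Brb t y *ᵥ z)) := by
    intro x z
    rw [Matrix.sub_mulVec, Matrix.one_mulVec, Matrix.smul_mulVec, dotProduct_sub, dotProduct_smul,
      smul_eq_mul]
  refine specNorm_le_of_symm (by linarith) (fun x z => ?_) fun x => ?_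
  · rw [key, key, dotProduct_comm, S.dotProduct_Brb, S.dotProduct_Brb, S.symm y hy]
  · have e : ‖∑ j, x j • S.ψ t j‖ = euclid x :=
      norm_sum_smul_of_orthonormal (S.orthonormal t ht) x
    have h1 := S.coercive hy (∑ j, x j • S.ψ t j)
    have h2 := (le_abs_self _).trans
      (S.cont y hy (∑ j, x j • S.ψ t j) (∑ j, x j • S.ψ t j))
    rw [← S.dotProduct_Brb, e] at h1 h2
    rw [key, ← euclid_sq_eq_dotProduct]
    have h3 := mul_le_mul_of_nonneg_left h1 hα.le
    have h4 := mul_le_mul_of_nonneg_left h2 hα.le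
    have h5 : alpha Ccont * Ccont * euclid x ^ 2 ≤ 1 / 2 * euclid x ^ 2 := by gcongr
    have h6 : (alpha Ccont * Ccoer) * euclid x ^ 2 ≤ 1 / 2 * euclid x ^ 2 := by
      gcongr; linarith
    have h7 := sq_nonneg (euclid x)
    rw [abs_le]
    constructor <;> linarith

lemma euclid_frb_le (ht : S.epsHat ≤ t) (hy : y ∈ S.Y) : euclid (S.frb t y) ≤ Crhs :=
  (euclid_load_le _ (S.orthonormal t ht)).trans (S.rhs y hy)

lemma euclid_urb_le (hcoer : 0 < Ccoer) (ht : S.epsHat ≤ t) (hy : y ∈ S.Y) :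
    euclid (S.urb t y) ≤ Ccoer⁻¹ * Crhs := by
  have h := (isUnit_of_le_euclid_mulVec hcoer (S.coer_mul_euclid_le ht hy)).2
  exact (euclid_mulVec_le _ _).trans
    (mul_le_mul h (S.euclid_frb_le ht hy) (euclid_nonneg _) (by positivity))

end ReducedBasisProblem

/-- The inverse of a perturbed matrix. -/
lemma specNorm_inv_sub_smul_le {d : ℕ} {B M W : Matrix (Fin d) (Fin d) ℝ} {a c e τ : ℝ}
    (ha : 0 < a) (hc : 0 < c) (hB : ∀ v, c * euclid v ≤ euclid (B *ᵥ v))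
    (hM : specNorm (a • B - M) ≤ e) (he : e ≤ a * c / 64) (hW : specNorm (M⁻¹ - W) ≤ τ) :
    specNorm (B⁻¹ - a • W) ≤ 64 / 63 * (e / (a * c ^ 2)) + a * τ := by
  obtain ⟨uB, iB⟩ := isUnit_of_le_euclid_mulVec hc hB
  -- The perturbation is at most `1/64` of the lower bound of `a B`, so `M` keeps `63/64` of it.
  have hMv : ∀ v, 63 / 64 * (a * c) * euclid v ≤ euclid (M *ᵥ v) := by
    intro v
    have h1 := (euclid_mulVec_le (a • B - M) v).trans
      (mul_le_mul_of_nonneg_right (hM.trans he) (euclid_nonneg v))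
    have h2 := euclid_le_add_sub (M *ᵥ v) ((a • B) *ᵥ v)
    rw [euclid_sub_comm, ← Matrix.sub_mulVec] at h2
    have h3 : euclid ((a • B) *ᵥ v) = a * euclid (B *ᵥ v) := by
      rw [Matrix.smul_mulVec, euclid, WithLp.toLp_smul, norm_smul, Real.norm_of_nonneg ha.le]; rfl
    have h4 := mul_le_mul_of_nonneg_left (hB v) ha.le
    linarith
  obtain ⟨uM, iM⟩ := isUnit_of_le_euclid_mulVec (by positivity) hMv
  have uB' := (Matrix.isUnit_iff_isUnit_det _).1 uB
  have uM' := (Matrix.isUnit_iff_isUnit_det _).1 uM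
  have e1 : B⁻¹ - a • W = B⁻¹ * (M - a • B) * M⁻¹ + a • (M⁻¹ - W) := by
    have h1 : B⁻¹ * (M - a • B) * M⁻¹ = B⁻¹ - a • M⁻¹ := by
      rw [Matrix.mul_sub, Matrix.sub_mul, Matrix.mul_assoc, Matrix.mul_nonsing_inv _ uM',
        Matrix.mul_one, Matrix.mul_smul, Matrix.nonsing_inv_mul _ uB', Matrix.smul_mul,
        Matrix.one_mul]
    rw [h1, smul_sub]; abel
  rw [e1]
  refine (specNorm_add_le _ _).trans (add_le_add ?_ ?_)
  · rw [specNorm_sub_comm] at hM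
    have he0 : 0 ≤ e := (specNorm_nonneg _).trans hM
    calc specNorm (B⁻¹ * (M - a • B) * M⁻¹)
        ≤ specNorm B⁻¹ * specNorm (M - a • B) * specNorm M⁻¹ :=
          (specNorm_mul_le _ _).trans (mul_le_mul_of_nonneg_right (specNorm_mul_le _ _)
            (specNorm_nonneg _))
      _ ≤ c⁻¹ * e * (63 / 64 * (a * c))⁻¹ := by
          gcongr <;> exact specNorm_nonneg _
      _ = _ := by field_simp
  · rw [specNorm_smul, abs_of_pos ha]
    gcongr

/-! ### The reduced-basis network -/

lemma realize_rbNet {p d : ℕ} (a : ℝ) (Φmult : NN (d * d + d) d) (Φinv : NN (d * d) (d * d))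
    (ΦB : NN p (d * d)) (Φf : NN p d) (y : Fin p → ℝ) :
    (rbNet a Φmult Φinv ΦB Φf).realize y = Φmult.realize (Fin.append
      (vec (a • matr (Φinv.realize (vec (1 - matr (ΦB.realize y)))))) (Φf.realize y)) := by
  have h1 : (idMinusNet ΦB).realize y = vec (1 - matr (ΦB.realize y)) := by
    ext c
    obtain ⟨⟨j, i⟩, rfl⟩ := finProdFinEquiv.surjective c
    rw [vec_apply]
    simp [idMinusNet, NN.realize_concat, NN.realize, Matrix.neg_mulVec, vec_apply, matr_apply]
    ring
  rw [rbNet, NN.realize_sparseConcat, NN.realize_par, invStiffnessNet, NN.realize_concat,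
    NN.realize_sparseConcat, h1, ← matr_smul, vec_matr, NN.realize, Matrix.smul_mulVec,
    Matrix.one_mulVec, add_zero]

lemma depth_invStiffnessNet {p d : ℕ} (a : ℝ) (Φinv : NN (d * d) (d * d)) (ΦB : NN p (d * d)) :
    (invStiffnessNet a Φinv ΦB).depth = Φinv.depth + ΦB.depth := by
  have h1 := NN.depth_concat_add_one (NN.last (-1 : Matrix (Fin (d * d)) (Fin (d * d)) ℝ) (vec 1)) ΦB
  have h2 := NN.depth_concat_add_one (NN.last (a • (1 : Matrix (Fin (d * d)) (Fin (d * d)) ℝ)) 0)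
    (NN.sparseConcat Φinv (idMinusNet ΦB))
  rw [NN.depth_sparseConcat] at h2
  simp only [NN.depth] at h1 h2
  rw [← idMinusNet] at h1
  rw [invStiffnessNet]
  omega

lemma depth_rbNet {p d : ℕ} (a : ℝ) (Φmult : NN (d * d + d) d) (Φinv : NN (d * d) (d * d))
    (ΦB : NN p (d * d)) (Φf : NN p d) :
    (rbNet a Φmult Φinv ΦB Φf).depth
      = Φmult.depth + max (Φinv.depth + ΦB.depth) Φf.depth := by
  rw [rbNet, NN.depth_sparseConcat, NN.depth_par, depth_invStiffnessNet]

/-- The `d²` terms come from the bias `vec(Id)` and from the identity layers that equalise the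
depths. The factor 4 for `Φinv` covers its possibly doubled first layer and its last layer, which is
doubled and then counted twice. -/
lemma weights_rbNet_le {p d : ℕ} (a : ℝ) (Φmult : NN (d * d + d) d) (Φinv : NN (d * d) (d * d))
    (ΦB : NN p (d * d)) (Φf : NN p d) :
    (rbNet a Φmult Φinv ΦB Φf).weights ≤ 2 * Φmult.weights + 4 * Φinv.weights
      + 2 * ΦB.weights + 2 * Φf.weights
      + (2 * d ^ 2 + 16 * d ^ 2 * (Φinv.depth + ΦB.depth + Φf.depth)) := by
  have w1 := NN.weights_sparseConcat_le Φmult (NN.par (invStiffnessNet a Φinv ΦB) Φf)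
  have w2 := NN.weights_par_le (invStiffnessNet a Φinv ΦB) Φf
  have w3 := NN.weights_concat_smul_le a (NN.sparseConcat Φinv (idMinusNet ΦB))
  have w4 := NN.lastWeights_concat_smul_le a (NN.sparseConcat Φinv (idMinusNet ΦB))
  rw [← invStiffnessNet] at w3 w4
  have w5 := NN.weights_sparseConcat_le Φinv (idMinusNet ΦB)
  have w6 := NN.lastWeights_sparseConcat_le Φinv (idMinusNet ΦB)
  have w7 := NN.weights_concat_neg_le (vec (1 : Matrix (Fin d) (Fin d) ℝ)) ΦB
  have w8 := NN.lastWeights_concat_neg_le (vec (1 : Matrix (Fin d) (Fin d) ℝ)) ΦB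
  rw [← idMinusNet] at w7 w8
  have w9 := nnzVec_le (vec (1 : Matrix (Fin d) (Fin d) ℝ))
  have f1 := Φmult.firstWeights_le
  have f2 := Φinv.firstWeights_le
  have f3 := Φinv.lastWeights_le
  have f4 := ΦB.lastWeights_le
  have f5 := Φf.lastWeights_le
  rw [depth_invStiffnessNet] at w2
  have hdd : d ≤ d * d := Nat.le_mul_self d
  have w10 : 8 * (d * d + d) * max (Φinv.depth + ΦB.depth) Φf.depth
      ≤ 16 * (d * d) * (Φinv.depth + ΦB.depth + Φf.depth) :=
    Nat.mul_le_mul (by omega) (by omega)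
  rw [← rbNet] at w1
  rw [sq]
  omega

lemma ApproxMult.mono {d : ℕ} {Φ : NN (d * d + d) d} {Z η η' : ℝ} (h : ApproxMult Φ Z η)
    (hη : η ≤ η') : ApproxMult Φ Z η' := fun A w hA hw => (h A w hA hw).trans hη

lemma ApproxInv.mono {d : ℕ} {Φ : NN (d * d) (d * d)} {r r' η η' : ℝ} (h : ApproxInv Φ r η)
    (hr : r' ≤ r) (hη : η ≤ η') : ApproxInv Φ r' η' := fun A hA => (h A (hA.trans hr)).trans hη

/-- The error of the reduced-basis network. -/
theorem euclid_urb_sub_realize_le {p D : ℕ} {H : Type u} [NormedAddCommGroup H]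
    [InnerProductSpace ℝ H] {Ccoer Ccont Crhs : ℝ} (hcoer : 0 < Ccoer) (hrhs : 0 < Crhs)
    (S : ReducedBasisProblem p D H Ccoer Ccont Crhs) {t ε : ℝ} (ht : S.epsHat ≤ t) (hε : 0 < ε)
    (hε' : ε < alpha Ccont / 4 * min 1 Ccoer)
    {Φmult : NN (S.d t * S.d t + S.d t) (S.d t)} {Φinv : NN (S.d t * S.d t) (S.d t * S.d t)}
    {ΦB : NN p (S.d t * S.d t)} {Φf : NN p (S.d t)} {y : Fin p → ℝ} (hy : y ∈ S.Y)
    (hmult : ApproxMult Φmult (kappa Ccoer Crhs) (ε / 12))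
    (hinv : ApproxInv Φinv (1 - alpha Ccont * Ccoer / 2) (eps1 Crhs ε / (8 * alpha Ccont)))
    (hB : specNorm (alpha Ccont • S.Brb t y - matr (ΦB.realize y)) ≤ eps3 Ccoer Ccont Crhs ε)
    (hf : euclid (S.frb t y - Φf.realize y) ≤ eps2 Ccoer ε) :
    euclid (S.urb t y - (rbNet (alpha Ccont) Φmult Φinv ΦB Φf).realize y) ≤ ε := by
  have hα := alpha_pos Ccont
  have hα2 := alpha_le_half Ccont
  have hαc : alpha Ccont * Ccoer ≤ 1 / 2 :=
    (mul_le_mul_of_nonneg_left (S.coer_le_cont ht) hα.le).trans (alpha_mul_le_half Ccont)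
  have hαc0 : 0 < alpha Ccont * Ccoer := by positivity
  have hm1 : min 1 Ccoer ≤ 1 := min_le_left _ _
  have hm2 : min 1 Ccoer ≤ Ccoer := min_le_right _ _
  have hεα : ε ≤ alpha Ccont / 4 := hε'.le.trans (mul_le_of_le_one_right (by positivity) hm1)
  have hεc : ε * Ccoer ≤ 1 / 8 := by nlinarith
  have hmax6 : 6 ≤ max 6 Crhs := le_max_left _ _
  have hmaxr : Crhs ≤ max 6 Crhs := le_max_right _ _
  set ε₁ := eps1 Crhs ε with hε₁
  have hε₁m : ε₁ * max 6 Crhs = ε := by rw [hε₁, eps1]; field_simp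
  have hε₁0 : 0 < ε₁ := by rw [hε₁, eps1]; positivity
  have hε₁6 : ε₁ ≤ ε / 6 := by nlinarith
  have hε₁r : ε₁ * Crhs ≤ ε := by nlinarith
  have hε₂ : eps2 Ccoer ε = ε / 3 * Ccoer := rfl
  have hε₃ : eps3 Ccoer Ccont Crhs ε = 3 / 8 * ε₁ * alpha Ccont * Ccoer ^ 2 := rfl
  -- This smallness keeps `M` invertible and leaves `1 - M` within the radius on which `Φinv` is
  -- accurate.
  have hε₃' : eps3 Ccoer Ccont Crhs ε ≤ alpha Ccont * Ccoer / 64 := by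
    have h1 : ε₁ * Ccoer ≤ 1 / 48 := by nlinarith
    calc eps3 Ccoer Ccont Crhs ε = 3 / 8 * (ε₁ * Ccoer) * (alpha Ccont * Ccoer) := by
          rw [hε₃]; ring
      _ ≤ 3 / 8 * (1 / 48) * (alpha Ccont * Ccoer) := by gcongr
      _ ≤ _ := by linarith
  set B := S.Brb t y with hBdef
  set M := matr (ΦB.realize y) with hM
  set W := matr (Φinv.realize (vec (1 - M))) with hW
  set f := S.frb t y with hfdef
  set g := Φf.realize y with hg
  have hA : specNorm (1 - M) ≤ 1 - alpha Ccont * Ccoer / 2 := by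
    have h1 := specNorm_add_le (1 - alpha Ccont • B) (alpha Ccont • B - M)
    rw [sub_add_sub_cancel] at h1
    have h2 := S.specNorm_one_sub_le ht hy
    linarith
  have hMW : specNorm (M⁻¹ - W) ≤ ε₁ / (8 * alpha Ccont) := by
    have h1 := hinv (1 - M) hA
    rwa [sub_sub_cancel] at h1
  have hlow := S.coer_mul_euclid_le ht hy
  have hBi := (isUnit_of_le_euclid_mulVec hcoer hlow).2
  -- `64/63 * 3/8 + 1/8 < 51/100`.
  have hN : specNorm (B⁻¹ - alpha Ccont • W) ≤ 51 / 100 * ε₁ := by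
    refine (specNorm_inv_sub_smul_le hα hcoer hlow hB hε₃' hMW).trans ?_
    have e1 : eps3 Ccoer Ccont Crhs ε / (alpha Ccont * Ccoer ^ 2) = 3 / 8 * ε₁ := by
      rw [hε₃]; field_simp
    have e2 : alpha Ccont * (ε₁ / (8 * alpha Ccont)) = ε₁ / 8 := by field_simp
    rw [e1, e2]
    linarith
  have hfb := S.euclid_frb_le ht hy
  have hgb : euclid g ≤ Crhs + 1 / 24 := by
    have h1 := euclid_le_add_sub f g
    rw [hε₂] at hf
    linarith
  have hκ1 : 2 ≤ kappa Ccoer Crhs := by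
    rw [kappa]; linarith [le_max_left 1 (max Crhs (1 / Ccoer))]
  have hκ2 : 2 * Crhs ≤ kappa Ccoer Crhs := by
    rw [kappa]
    have := (le_max_left Crhs (1 / Ccoer)).trans (le_max_right 1 _)
    linarith
  have hκ3 : 2 * Ccoer⁻¹ ≤ kappa Ccoer Crhs := by
    rw [kappa, ← one_div]
    have := (le_max_right Crhs (1 / Ccoer)).trans (le_max_right 1 _)
    linarith
  have hNκ : specNorm (alpha Ccont • W) ≤ kappa Ccoer Crhs := by
    have h1 := specNorm_sub_le B⁻¹ (B⁻¹ - alpha Ccont • W)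
    rw [sub_sub_cancel] at h1
    linarith
  have hmul := hmult (alpha Ccont • W) g hNκ (by linarith)
  rw [realize_rbNet]
  -- The errors of the right-hand side, the inverse and the product are at most `ε/3`, `52/100 ε`
  -- and `ε/12`, with sum below `ε`.
  have e : S.urb t y - Φmult.realize (Fin.append (vec (alpha Ccont • W)) g)
      = B⁻¹ *ᵥ (f - g) + (B⁻¹ - alpha Ccont • W) *ᵥ g
        + ((alpha Ccont • W) *ᵥ g - Φmult.realize (Fin.append (vec (alpha Ccont • W)) g)) := by
    rw [ReducedBasisProblem.urb, ← hBdef, ← hfdef, Matrix.mulVec_sub, Matrix.sub_mulVec]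
    abel
  rw [e]
  have t1 : euclid (B⁻¹ *ᵥ (f - g)) ≤ ε / 3 := by
    calc _ ≤ Ccoer⁻¹ * eps2 Ccoer ε :=
          (euclid_mulVec_le _ _).trans (mul_le_mul hBi hf (euclid_nonneg _) (by positivity))
      _ = ε / 3 := by rw [hε₂]; field_simp
  have t2 : euclid ((B⁻¹ - alpha Ccont • W) *ᵥ g) ≤ 52 / 100 * ε := by
    calc _ ≤ 51 / 100 * ε₁ * (Crhs + 1 / 24) :=
          (euclid_mulVec_le _ _).trans (mul_le_mul hN hgb (euclid_nonneg _) (by positivity))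
      _ ≤ 52 / 100 * ε := by linarith
  have t3 := euclid_add_le (B⁻¹ *ᵥ (f - g) + (B⁻¹ - alpha Ccont • W) *ᵥ g)
    ((alpha Ccont • W) *ᵥ g - Φmult.realize (Fin.append (vec (alpha Ccont • W)) g))
  have t4 := euclid_add_le (B⁻¹ *ᵥ (f - g)) ((B⁻¹ - alpha Ccont • W) *ᵥ g)
  linarith

/-! ### Numerical estimates behind the final bounds -/

lemma inv_mul_le_kappa_sq {Ccoer Crhs : ℝ} (hrhs : 0 < Crhs) :
    Ccoer⁻¹ * Crhs ≤ kappa Ccoer Crhs ^ 2 / 4 := by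
  have h1 : Crhs ≤ max 1 (max Crhs (1 / Ccoer)) := (le_max_left _ _).trans (le_max_right _ _)
  have h2 : Ccoer⁻¹ ≤ max 1 (max Crhs (1 / Ccoer)) := by
    rw [← one_div]; exact (le_max_right _ _).trans (le_max_right _ _)
  calc Ccoer⁻¹ * Crhs ≤ max 1 (max Crhs (1 / Ccoer)) * max 1 (max Crhs (1 / Ccoer)) := by gcongr
    _ = _ := by rw [kappa]; ring

lemma depth_estimate {C₁ C₂ l ll ld a b : ℝ} (hC₁ : 0 < C₁) (hl : 3 < l)
    (hll : 1 < ll) (hld : 0 ≤ ld) (ha : a ≤ C₁ * (l + ld)) (hb : b ≤ C₂ * ll * (l + ll + ld)) :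
    1 + a + b ≤ (C₁ + C₂ + 1) * ll * (l + ll + ld) := by
  have h0 : 0 ≤ l + ll + ld := by linarith
  have h1 : l + ll + ld ≤ ll * (l + ll + ld) := le_mul_of_one_le_left h0 hll.le
  have h2 : C₁ * (l + ld) ≤ C₁ * (ll * (l + ll + ld)) := by gcongr; linarith
  linarith

/-- All multiplication and inversion terms are dominated by `d² R` with `R = d l ll² (l + ll + ld)`,
in which the factor `l ll` is slack. The bare `2 d²` is absorbed by `LB ≥ 1`. -/
lemma weights_estimate {C₁ C₂ d l ll ld wm wi Li LB Lf : ℝ} (hC₁ : 0 < C₁) (hC₂ : 0 < C₂)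
    (hd : 1 ≤ d) (hl : 3 < l) (hll : 1 < ll) (hld : 0 ≤ ld) (hB : 1 ≤ LB) (hf : 0 ≤ Lf)
    (hm : wm ≤ C₁ * d ^ 2 * (l + ld)) (hi : wi ≤ C₂ * d ^ 3 * ll * (l + ll + ld))
    (hLi : Li ≤ C₂ * ll * (l + ll + ld)) :
    2 * wm + 4 * wi + (2 * d ^ 2 + 16 * d ^ 2 * (Li + LB + Lf))
      ≤ (2 * C₁ + 20 * C₂ + 18) * d ^ 2 * (d * l * ll ^ 2 * (l + ll + ld) + LB + Lf) := by
  set Q := l + ll + ld with hQ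
  have hQ0 : 0 ≤ Q := by linarith
  have hd2 : 0 ≤ d ^ 2 := by positivity
  have hll2 : ll ≤ l * ll ^ 2 := by
    calc ll = 1 * (1 * ll) := by ring
      _ ≤ l * (ll * ll) := by gcongr; linarith
      _ = _ := by ring
  have hR' : d * (ll * Q) ≤ d * l * ll ^ 2 * Q := by
    calc d * (ll * Q) ≤ d * ((l * ll ^ 2) * Q) := by gcongr
      _ = _ := by ring
  have hR : ll * Q ≤ d * l * ll ^ 2 * Q :=
    (le_mul_of_one_le_left (by positivity) hd).trans hR'
  set R := d * l * ll ^ 2 * Q with hRdef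
  have hQR : l + ld ≤ R := by
    have : Q ≤ ll * Q := le_mul_of_one_le_left hQ0 hll.le
    linarith
  have hR0 : 0 ≤ R := by linarith
  have a1 : wm ≤ C₁ * d ^ 2 * R := hm.trans (by gcongr)
  have a2 : wi ≤ C₂ * d ^ 2 * R := by
    calc wi ≤ C₂ * d ^ 2 * (d * (ll * Q)) := hi.trans_eq (by ring)
      _ ≤ _ := by gcongr
  have a3 : d ^ 2 * Li ≤ C₂ * d ^ 2 * R := by
    calc d ^ 2 * Li ≤ d ^ 2 * (C₂ * ll * Q) := by gcongr
      _ = C₂ * d ^ 2 * (ll * Q) := by ring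
      _ ≤ _ := by gcongr
  have a4 : d ^ 2 * 1 ≤ d ^ 2 * LB := by gcongr
  have a5 : 0 ≤ (2 * C₁ + 20 * C₂) * d ^ 2 * (LB + Lf) := by positivity
  have a6 : 0 ≤ d ^ 2 * R := by positivity
  have a7 : 0 ≤ d ^ 2 * Lf := by positivity
  linarith

end RBNN

/-! ### The main theorem -/

open RBNN
theorem mainTheorem2 (Ccoer Ccont Crhs : ℝ) (hcoer : 0 < Ccoer) (hcont : 0 < Ccont)
    (hrhs : 0 < Crhs) :
    ∃ CL > (0 : ℝ), ∃ CM > (0 : ℝ),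
    ∃ (Φmult : (d : ℕ) → ℝ → NN (d * d + d) d) (Φinv : (d : ℕ) → ℝ → NN (d * d) (d * d)),
      (∀ (d : ℕ) (ε : ℝ), 1 ≤ d → 0 < ε → ε < alpha Ccont / 4 * min 1 Ccoer →
        ApproxMult (Φmult d ε) (kappa Ccoer Crhs) (ε / 3) ∧
        ApproxInv (Φinv d ε) (1 - alpha Ccont * Ccoer / 2)
          (eps1 Crhs ε / (2 * alpha Ccont))) ∧
      ∀ (p D : ℕ) (H : Type u) [NormedAddCommGroup H] [InnerProductSpace ℝ H] [CompleteSpace H]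
        (S : ReducedBasisProblem p D H Ccoer Ccont Crhs)
        (ΦB : (t : ℝ) → ℝ → NN p (S.d t * S.d t)) (Φf : (t : ℝ) → ℝ → NN p (S.d t)),
        (∀ t, S.epsHat ≤ t → ∀ η > 0, ∀ y ∈ S.Y,
          specNorm (alpha Ccont • S.Brb t y - matr ((ΦB t η).realize y)) ≤ η) →
        (∀ t, S.epsHat ≤ t → ∀ η > 0, ∀ y ∈ S.Y,
          euclid (S.frb t y - (Φf t η).realize y) ≤ η) →
        ∀ (t ε : ℝ), S.epsHat ≤ t → 0 < ε → ε < alpha Ccont / 4 * min 1 Ccoer →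
        let d : ℕ := S.d t
        let Bnet : NN p (d * d) := ΦB t (eps3 Ccoer Ccont Crhs ε)
        let fnet : NN p d := Φf t (eps2 Ccoer ε)
        let Φrb : NN p d := rbNet (alpha Ccont) (Φmult d ε) (Φinv d ε) Bnet fnet
        let Φh : NN p D := hNet (S.V t) Φrb
        let l : ℝ := Real.logb 2 (1 / ε)
        let ll : ℝ := Real.logb 2 (Real.logb 2 (1 / ε))
        -- accuracy
        (∀ y ∈ S.Y, euclid (S.urb t y - Φrb.realize y) ≤ ε) ∧
        (∀ y ∈ S.Y, gNorm S.φ (S.uh t y - Φh.realize y) ≤ ε) ∧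
        -- number of layers
        Φrb.depth ≤ Φh.depth ∧
        (Φh.depth : ℝ) ≤ CL * ll * (l + ll + Real.logb 2 d) + max (Bnet.depth : ℝ) fnet.depth ∧
        -- number of weights
        (Φrb.weights : ℝ) ≤
          CM * (d : ℝ) ^ 2 * (d * l * ll ^ 2 * (l + ll + Real.logb 2 d)
            + Bnet.depth + fnet.depth) + 2 * Bnet.weights + 2 * fnet.weights ∧
        Φh.weights ≤ 2 * D * d + 2 * Φrb.weights ∧
        -- uniform bounds
        (∀ y ∈ S.Y, euclid (Φrb.realize y) ≤ kappa Ccoer Crhs ^ 2 + ε / 3) ∧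
        (∀ y ∈ S.Y, gNorm S.φ (Φh.realize y) ≤ kappa Ccoer Crhs ^ 2 + ε / 3) := by
  have hα := alpha_pos Ccont
  have hα2 := alpha_le_half Ccont
  have hκ1 : 2 ≤ kappa Ccoer Crhs := by
    rw [kappa]; linarith [le_max_left 1 (max Crhs (1 / Ccoer))]
  have hε8 : ∀ {ε : ℝ}, ε < alpha Ccont / 4 * min 1 Ccoer → ε < 1 / 8 := fun hε =>
    hε.trans_le ((mul_le_of_le_one_right (by positivity) (min_le_left _ _)).trans (by linarith))
  have hc : ∀ ε, 1 / (max 6 Crhs * (8 * alpha Ccont)) * ε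
      = eps1 Crhs ε / (8 * alpha Ccont) := by
    intro ε
    rw [eps1, div_div, one_div_mul_eq_div]
  obtain ⟨C₁, hC₁, h₁⟩ := exists_multNet_complexity (Z := kappa Ccoer Crhs) (by linarith)
  -- The maximum with `1/2` ensures a nonnegative radius: `Ccoer ≤ Ccont` follows only once a
  -- problem is given, and the networks are chosen before that.
  obtain ⟨C₂, hC₂, h₂⟩ := exists_invNet_complexity
    (r := max (1 - alpha Ccont * Ccoer / 2) (1 / 2)) (c := 1 / (max 6 Crhs * (8 * alpha Ccont)))
    (le_max_of_le_right (by norm_num))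
    (max_lt (by linarith [mul_pos hα hcoer]) (by norm_num)) (by positivity)
  -- The networks are four times more accurate than the statement announces (`ε / 12`, `ε' / (8α)`);
  -- the error splitting uses this margin.
  have h₁' : ∀ (d : ℕ) (ε : ℝ), ∃ Φ : NN (d * d + d) d, 1 ≤ d → 0 < ε → ε < 1 / 8 →
      ApproxMult Φ (kappa Ccoer Crhs) (ε / 12) ∧
        (Φ.depth : ℝ) ≤ C₁ * (Real.logb 2 (1 / ε) + Real.logb 2 d) ∧
        (Φ.weights : ℝ) ≤ C₁ * d ^ 2 * (Real.logb 2 (1 / ε) + Real.logb 2 d) := by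
    intro d ε
    by_cases h : 1 ≤ d ∧ 0 < ε ∧ ε < 1 / 8
    · obtain ⟨Φ, hΦ⟩ := h₁ d ε h.1 h.2.1 h.2.2
      exact ⟨Φ, fun _ _ _ => hΦ⟩
    -- An arbitrary network outside the admissible range, so that the choice is a total function of
    -- `d` and `ε`.
    · exact ⟨NN.last 0 0, fun a b c => absurd ⟨a, b, c⟩ h⟩
  have h₂' : ∀ (d : ℕ) (ε : ℝ), ∃ Φ : NN (d * d) (d * d), 1 ≤ d → 0 < ε → ε < 1 / 8 →
      ApproxInv Φ (1 - alpha Ccont * Ccoer / 2) (eps1 Crhs ε / (8 * alpha Ccont)) ∧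
        (Φ.depth : ℝ) ≤ C₂ * Real.logb 2 (Real.logb 2 (1 / ε)) *
          (Real.logb 2 (1 / ε) + Real.logb 2 (Real.logb 2 (1 / ε)) + Real.logb 2 d) ∧
        (Φ.weights : ℝ) ≤ C₂ * d ^ 3 * Real.logb 2 (Real.logb 2 (1 / ε)) *
          (Real.logb 2 (1 / ε) + Real.logb 2 (Real.logb 2 (1 / ε)) + Real.logb 2 d) := by
    intro d ε
    by_cases h : 1 ≤ d ∧ 0 < ε ∧ ε < 1 / 8
    · obtain ⟨Φ, hΦ, hΦ'⟩ := h₂ d ε h.1 h.2.1 h.2.2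
      exact ⟨Φ, fun _ _ _ => ⟨hΦ.mono (le_max_left _ _) (hc ε).le, hΦ'⟩⟩
    · exact ⟨NN.last 0 0, fun a b c => absurd ⟨a, b, c⟩ h⟩
  choose Φmult hmult using h₁'
  choose Φinv hinv using h₂'
  refine ⟨C₁ + C₂ + 1, by positivity, 2 * C₁ + 20 * C₂ + 18, by positivity, Φmult, Φinv, ?_, ?_⟩
  · intro d ε hd h0 h1
    refine ⟨(hmult d ε hd h0 (hε8 h1)).1.mono (by linarith),
      (hinv d ε hd h0 (hε8 h1)).1.mono le_rfl ?_⟩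
    have : 0 < eps1 Crhs ε := by rw [eps1]; positivity
    gcongr
    norm_num
  · intro p D H _ _ _ S ΦB Φf hB hf t ε ht h0 h1 d Bnet fnet Φrb Φh l ll
    have hd : 1 ≤ d := S.d_pos t ht
    obtain ⟨m1, m2, m3⟩ := hmult d ε hd h0 (hε8 h1)
    obtain ⟨i1, i2, i3⟩ := hinv d ε hd h0 (hε8 h1)
    have he2 : 0 < eps2 Ccoer ε := by rw [eps2]; positivity
    have he3 : 0 < eps3 Ccoer Ccont Crhs ε := by rw [eps3, eps1]; positivity
    have hacc : ∀ y ∈ S.Y, euclid (S.urb t y - Φrb.realize y) ≤ ε := fun y hy =>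
      euclid_urb_sub_realize_le hcoer hrhs S ht h0 h1 hy m1 i1 (hB t ht _ he3 y hy)
        (hf t ht _ he2 y hy)
    have hΦh : ∀ y, Φh.realize y = (S.V t).mulVec (Φrb.realize y) := by
      intro y
      simp only [Φh, hNet, NN.realize_sparseConcat, NN.realize, add_zero]
    have hV : ∀ x, gNorm S.φ ((S.V t).mulVec x) = euclid x := gNorm_mulVec _ _ (S.orthonormal t ht)
    -- The exact solution is bounded by `κ² / 4`, so the full error `ε` fits into the claim because
    -- `κ ≥ 2` and `ε < 1/8`.
    have hbound : ∀ y ∈ S.Y, euclid (Φrb.realize y) ≤ kappa Ccoer Crhs ^ 2 + ε / 3 := by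
      intro y hy
      have b1 := euclid_le_add_sub (S.urb t y) (Φrb.realize y)
      have b2 := S.euclid_urb_le hcoer ht hy
      have b3 := hacc y hy
      have b4 := inv_mul_le_kappa_sq (Ccoer := Ccoer) hrhs
      have b5 := hε8 h1
      nlinarith
    have hl := three_lt_logb h0 (hε8 h1)
    have hll := one_lt_logb_logb h0 (hε8 h1)
    have hld := logb_natCast_nonneg d hd
    have hdepth : Φrb.depth = (Φmult d ε).depth + max ((Φinv d ε).depth + Bnet.depth) fnet.depth :=
      depth_rbNet _ _ _ _ _
    have hdepth' : Φh.depth = 1 + Φrb.depth := NN.depth_sparseConcat _ _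
    have hweights := weights_rbNet_le (alpha Ccont) (Φmult d ε) (Φinv d ε) Bnet fnet
    refine ⟨hacc, ?_, ?_, ?_, ?_, NN.weights_sparseConcat_last_zero_le _ _, hbound, ?_⟩
    · intro y hy
      rw [hΦh, ReducedBasisProblem.uh, ← Matrix.mulVec_sub, hV]
      exact hacc y hy
    · omega
    · have hmax : Φh.depth ≤ 1 + (Φmult d ε).depth + (Φinv d ε).depth
          + max Bnet.depth fnet.depth := by
        rw [hdepth', hdepth]; omega
      have hmax' : (Φh.depth : ℝ) ≤ 1 + (Φmult d ε).depth + (Φinv d ε).depth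
          + max (Bnet.depth : ℝ) fnet.depth := by exact_mod_cast hmax
      exact hmax'.trans (add_le_add_left (depth_estimate hC₁ hl hll hld m2 i2) _)
    · have hw : (Φrb.weights : ℝ) ≤ 2 * (Φmult d ε).weights + 4 * (Φinv d ε).weights
          + 2 * Bnet.weights + 2 * fnet.weights
          + (2 * d ^ 2 + 16 * d ^ 2 * ((Φinv d ε).depth + Bnet.depth + fnet.depth)) := by
        exact_mod_cast hweights
      have hd1 : (1 : ℝ) ≤ d := by exact_mod_cast hd
      have hB1 : (1 : ℝ) ≤ Bnet.depth := by exact_mod_cast Bnet.depth_pos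
      have := weights_estimate hC₁ hC₂ hd1 hl hll hld hB1 (Nat.cast_nonneg fnet.depth) m3 i3 i2
      linarith
    · intro y hy
      rw [hΦh, hV]
      exact hbound y hy
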